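/- **Setting.** Let $X$ be a complex Hilbert space and let $A:D(A)\to X$ be the generator of a strongly continuous semigroup $\mathbb T=(\mathbb T_t)_{t\ge 0}$ on $X$. Fix $\beta\in\rho(A)$. Let $X_1$ be $D(A)$ with the norm $\|x\|_1=\|(\beta I-A)x\|$ and let $X_{-1}$ be the completion of $X$ for the norm $\|x\|_{-1}=\|(\beta I-A)^{-1}x\|$. The operators $\mathbb T_t$, $A$ and $(sI-A)^{-1}$ ($s\in\rho(A)$) extend by continuity to bounded operators $X_{-1}\to X_{-1}$, $X\to X_{-1}$ and $X_{-1}\to X$, denoted by the same symbols. * $B\in\mathcal L(\mathbb C^m,X_{-1})$ is an *admissible control operator* for $\mathbb T$ if for some $\tau>0$ we have $\int_0^\tau\mathbb T_{\tau-s}Bu(s)\,ds\in X$ for all $u\in L^2([0,\infty);\mathbb C^m)$. * $C\in\mathcal L(X_1,\mathbb C^p)$ is an *admissible observation operator* for $\mathbb T$ if for some $\tau>0$ there is $m_\tau>0$ with $\int_0^\tau\|C\mathbb T_tx\|^2\,dt\le m_\tau\|x\|^2$ for all $x\in D(A)$. Its $\Lambda$-extension is $C_\Lambda x=\lim_{\lambda\to+\infty}C\lambda(\lambda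 I-A)^{-1}x$, with domain $D(C_\Lambda)$ the set of all $x\in X$ for which this limit exists. * For Hilbert spaces $U,Y$ and $B\in\mathcal L(U,X_{-1})$, let $Z=D(A)+(\beta I-A)^{-1}BU$ with $\|z\|_Z^2=\inf\{\|x\|_1^2+\|v\|^2 : x\in D(A),\ v\in U,\ z=x+(\beta I-A)^{-1}Bv\}$. For an operator $\mathcal C:D(\mathcal C)\to Y$ with $D(\mathcal C)\subset X$, and $D\in\mathcal L(U,Y)$, the quadruple $(A,B,\mathcal C,D)$ is a *compatible system node* on $(U,X,Y)$ if $Z\subset D(\mathcal C)$ and $\mathcal C|_Z\in\mathcal L(Z,Y)$. A *classical solution* on $[0,\infty)$ is a triple $(x,u,y)$ with $x\in C^1([0,\infty);X)$, $u\in C([0,\infty);U)$, $y\in C([0,\infty);Y)$ such that $Ax(t)+Bu(t)\in X$, $\dot x(t)=Ax(t)+Bu(t)$ and $y(t)=\mathcal Cx(t)+Du(t)$ for all $t\ge0$. The node is *well-posed* if for every $\tau>0$ there is $K_\tau>0$ such that every classical solution satisfies $$\|x(\tau)\|^2+\int_0^\tau\|y(t)\|^2dt\le K_\tau\Big(\|x(0)\|^2+\int_0^\tau\|u(t)\|^2dt\Big).$$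 It is *strictly proper* if its transfer function $\mathbf G(s)=\mathcal C(sI-A)^{-1}B+D$ satisfies $\|\mathbf G(s)\|\to0$ as $\operatorname{Re}s\to\infty$, uniformly in $\operatorname{Im}s$; that is, there are $\alpha\in\mathbb R$ and a continuous $b:(\alpha,\infty)\to(0,\infty)$ with $b(\xi)\to0$ as $\xi\to\infty$, such that $\mathbf G(s)$ is defined and $\|\mathbf G(s)\|\le b(\operatorname{Re}s)$ whenever $\operatorname{Re}s>\alpha$. **Corollary.** Let $B\in\mathcal L(\mathbb C^m,X_{-1})$ be an admissible control operator for $\mathbb T$ and let $C\in\mathcal L(X_1,\mathbb C^p)$ be an admissible observation operator for $\mathbb T$. Assume that there is a Riesz basis $(\phi_k)_{k=1,2,3,\ldots}$ of $X$ (the image of the standard basis of $\ell^2$ under a bounded operator with bounded inverse) consisting of eigenvectors of $A$, whose eigenvalues satisfy $\mu_k=iak^2+O(1)$ for some $a>0$. Then $(A,B,C_\Lambda,0)$ is a compatible system node on $(\mathbb C^m,X,\mathbb C^p)$ that is well-posed and strictly proper. -/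

import Mathlib

open Filter Topology MeasureTheory Set
open scoped NNReal

noncomputable section

set_option linter.unusedSectionVars false

section Semigroups

variable {X : Type*} [NormedAddCommGroup X] [NormedSpace ℂ X]

/-- A strongly continuous semigroup of bounded operators `(T t)`, `t ≥ 0`, on `X`. -/
structure C0Semigroup (X : Type*) [NormedAddCommGroup X] [NormedSpace ℂ X] where
  op : ℝ≥0 → X →L[ℂ] X
  op_zero : op 0 = ContinuousLinearMap.id ℂ X
  op_add : ∀ s t : ℝ≥0, op (s + t) = (op s).comp (op t)
  strongly_continuous : ∀ x : X, Continuous fun t : ℝ≥0 => op t x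

/-- The generator relation `A x = y`, that is `(T t x - x) / t → y` as `t → 0`, `t > 0`. -/
def C0Semigroup.GenRel (T : C0Semigroup X) (x y : X) : Prop :=
  Tendsto (fun t : ℝ≥0 => (((t : ℝ) : ℂ))⁻¹ • (T.op t x - x)) (𝓝[>] 0) (𝓝 y)

theorem C0Semigroup.GenRel.add {T : C0Semigroup X} {x y x' y' : X}
    (h : T.GenRel x y) (h' : T.GenRel x' y') : T.GenRel (x + x') (y + y') := by
  unfold C0Semigroup.GenRel at *
  refine (Tendsto.add h h').congr fun t => ?_
  rw [← smul_add, map_add]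
  congr 1
  abel

theorem C0Semigroup.GenRel.smul {T : C0Semigroup X} {x y : X}
    (h : T.GenRel x y) (c : ℂ) : T.GenRel (c • x) (c • y) := by
  unfold C0Semigroup.GenRel at *
  refine (Tendsto.const_smul h c).congr fun t => ?_
  rw [map_smul, ← smul_sub, smul_comm]

theorem C0Semigroup.GenRel.unique {T : C0Semigroup X} {x y y' : X}
    (h : T.GenRel x y) (h' : T.GenRel x y') : y = y' :=
  tendsto_nhds_unique h h'

/-- The generator `A : D(A) → X` of the semigroup. -/
def C0Semigroup.generator (T : C0Semigroup X) : X →ₗ.[ℂ] X where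
  domain :=
    { carrier := {x | ∃ y, T.GenRel x y}
      add_mem' := fun ⟨_, h⟩ ⟨_, h'⟩ => ⟨_, h.add h'⟩
      zero_mem' := ⟨0, by simp [C0Semigroup.GenRel]⟩
      smul_mem' := fun c _ ⟨_, h⟩ => ⟨_, h.smul c⟩ }
  toFun :=
    { toFun := fun x => Classical.choose x.2
      map_add' := fun x x' => (Classical.choose_spec (x + x').2).unique
        ((Classical.choose_spec x.2).add (Classical.choose_spec x'.2))
      map_smul' := fun c x => (Classical.choose_spec (c • x).2).unique
        ((Classical.choose_spec x.2).smul c) }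

theorem C0Semigroup.genRel_generator (T : C0Semigroup X) (x : T.generator.domain) :
    T.GenRel x (T.generator x) :=
  Classical.choose_spec x.2

theorem C0Semigroup.GenRel.op {T : C0Semigroup X} {x y : X}
    (h : T.GenRel x y) (t : ℝ≥0) : T.GenRel (T.op t x) (T.op t y) := by
  unfold C0Semigroup.GenRel at *
  refine (((T.op t).continuous.tendsto y).comp h).congr fun s => ?_
  have : T.op s (T.op t x) = T.op t (T.op s x) := by
    rw [← ContinuousLinearMap.comp_apply, ← T.op_add, add_comm, T.op_add,
      ContinuousLinearMap.comp_apply]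
  simp only [Function.comp_apply, map_smul, map_sub, this]

theorem C0Semigroup.op_mem_domain (T : C0Semigroup X) (t : ℝ≥0) (x : T.generator.domain) :
    T.op t x ∈ T.generator.domain :=
  ⟨_, (T.genRel_generator x).op t⟩

theorem C0Semigroup.generator_op (T : C0Semigroup X) (t : ℝ≥0) (x : T.generator.domain) :
    T.generator ⟨T.op t x, T.op_mem_domain t x⟩ = T.op t (T.generator x) :=
  (T.genRel_generator _).unique ((T.genRel_generator x).op t)

/-- The domain of a generator is dense; hence bounded operators on it extend uniquely to `X`. -/
theorem C0Semigroup.dense_domain [CompleteSpace X] (T : C0Semigroup X) :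
    DenseRange T.generator.domain.subtype := by
  intro x
  set g : ℝ → X := fun s => T.op s.toNNReal x with hg
  have hgc : Continuous g := (T.strongly_continuous x).comp continuous_real_toNNReal
  have hg0 : g 0 = x := by simp [hg, T.op_zero]
  set F : ℝ → X := fun r => ∫ s in (0 : ℝ)..r, g s with hF
  have hFd : ∀ r, HasDerivAt F (g r) r := fun r =>
    intervalIntegral.integral_hasDerivAt_right (hgc.intervalIntegrable _ _)
      (hgc.stronglyMeasurableAtFilter _ _) hgc.continuousAt
  have hF0 : F 0 = 0 := by simp [hF]
  have hnn : Tendsto (fun t : ℝ≥0 => (t : ℝ)) (𝓝[>] 0) (𝓝[≠] (0 : ℝ)) := by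
    refine tendsto_nhdsWithin_iff.2 ⟨?_, ?_⟩
    · exact (NNReal.continuous_coe.tendsto 0).mono_left nhdsWithin_le_nhds
    · filter_upwards [self_mem_nhdsWithin] with t ht
      exact (NNReal.coe_pos.2 ht).ne'
  have hdom : ∀ h : ℝ, 0 ≤ h → F h ∈ T.generator.domain := by
    intro h hh
    refine ⟨g h - g 0, ?_⟩
    unfold C0Semigroup.GenRel
    have h1 := (hasDerivAt_iff_tendsto_slope_zero.1 (hFd h)).comp hnn
    have h2 := (hasDerivAt_iff_tendsto_slope_zero.1 (hFd 0)).comp hnn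
    refine (h1.sub h2).congr fun t => ?_
    have key : T.op t (F h) = F (h + t) - F t := by
      rw [hF]
      simp only
      rw [← ContinuousLinearMap.intervalIntegral_comp_comm _ (hgc.intervalIntegrable _ _)]
      rw [intervalIntegral.integral_interval_sub_left (hgc.intervalIntegrable _ _)
        (hgc.intervalIntegrable _ _)]
      have := intervalIntegral.integral_comp_add_right (a := 0) (b := h) g (t : ℝ)
      rw [zero_add] at this
      rw [← this]
      refine intervalIntegral.integral_congr fun s hs => ?_
      rw [uIcc_of_le hh] at hs
      simp only [hg]
      have hst : (s + (t : ℝ)).toNNReal = t + s.toNNReal := by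
        rw [Real.toNNReal_add hs.1 t.coe_nonneg, Real.toNNReal_coe, add_comm]
      rw [hst, T.op_add]
      rfl
    simp only [Function.comp_apply, zero_add, hF0, sub_zero, key]
    rw [← smul_sub, ← Complex.ofReal_inv, Complex.coe_smul]
    congr 1
    abel
  have hlim : Tendsto (fun t : ℝ≥0 => (t : ℝ)⁻¹ • F t) (𝓝[>] 0) (𝓝 x) := by
    have h2 := (hasDerivAt_iff_tendsto_slope_zero.1 (hFd 0)).comp hnn
    rw [hg0] at h2
    refine h2.congr fun t => ?_
    simp [hF0]
  refine mem_closure_of_tendsto hlim (Eventually.of_forall fun t => ?_)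
  refine ⟨⟨_, T.generator.domain.smul_mem (((t : ℝ)⁻¹ : ℝ) : ℂ) (hdom t t.2)⟩, ?_⟩
  exact Complex.coe_smul _ _

/-- The restriction of `T t` to `D(A)`. -/
def C0Semigroup.opDomain (T : C0Semigroup X) (t : ℝ≥0) :
    T.generator.domain →ₗ[ℂ] T.generator.domain :=
  ((T.op t).toLinearMap.comp T.generator.domain.subtype).codRestrict _
    fun x => T.op_mem_domain t x

end Semigroups

section Resolvents

variable {X : Type*} [NormedAddCommGroup X] [NormedSpace ℂ X]

/-- `s I - A : D(A) → X`. -/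
def shiftOp (A : X →ₗ.[ℂ] X) (s : ℂ) : A.domain →ₗ[ℂ] X :=
  s • A.domain.subtype - A.toFun

/-- The resolvent set `ρ(A)` of an unbounded operator: `s I - A` is a bijection from `D(A)` to
`X` and its inverse is bounded. -/
def resolvSet (A : X →ₗ.[ℂ] X) : Set ℂ :=
  {s | Function.Bijective (shiftOp A s) ∧
    ∃ M : ℝ, ∀ x : A.domain, ‖(x : X)‖ ≤ M * ‖shiftOp A s x‖}

open scoped Classical in
/-- `(s I - A)⁻¹ : X → D(A)` for `s ∈ ρ(A)` (and `0` for other `s`). -/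
def resolvDom (A : X →ₗ.[ℂ] X) (s : ℂ) : X →ₗ[ℂ] A.domain :=
  if h : s ∈ resolvSet A then (LinearEquiv.ofBijective (shiftOp A s) h.1).symm.toLinearMap else 0

theorem shiftOp_resolvDom {A : X →ₗ.[ℂ] X} {s : ℂ} (hs : s ∈ resolvSet A) (x : X) :
    shiftOp A s (resolvDom A s x) = x := by
  rw [resolvDom, dif_pos hs]
  exact LinearEquiv.apply_symm_apply (LinearEquiv.ofBijective (shiftOp A s) hs.1) x

theorem resolvDom_shiftOp {A : X →ₗ.[ℂ] X} {s : ℂ} (hs : s ∈ resolvSet A) (x : A.domain) :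
    resolvDom A s (shiftOp A s x) = x :=
  hs.1.1 (shiftOp_resolvDom hs _)

theorem resolvDom_bound (A : X →ₗ.[ℂ] X) (s : ℂ) :
    ∃ M : ℝ, ∀ x : X, ‖(A.domain.subtype.comp (resolvDom A s)) x‖ ≤ M * ‖x‖ := by
  by_cases hs : s ∈ resolvSet A
  · obtain ⟨M, hM⟩ := hs.2
    exact ⟨M, fun x => by simpa [shiftOp_resolvDom hs] using hM (resolvDom A s x)⟩
  · exact ⟨0, fun x => by simp [resolvDom, hs]⟩

/-- `(s I - A)⁻¹` as a bounded operator on `X`. -/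
def resolv (A : X →ₗ.[ℂ] X) (s : ℂ) : X →L[ℂ] X :=
  (A.domain.subtype.comp (resolvDom A s)).mkContinuousOfExistsBound (resolvDom_bound A s)

theorem resolv_apply (A : X →ₗ.[ℂ] X) (s : ℂ) (x : X) : resolv A s x = resolvDom A s x := rfl

theorem resolv_injective {A : X →ₗ.[ℂ] X} {s : ℂ} (hs : s ∈ resolvSet A) :
    Function.Injective (resolv A s) := fun x y h => by
  rw [resolv_apply, resolv_apply] at h
  rw [← shiftOp_resolvDom hs x, Subtype.ext h, shiftOp_resolvDom hs y]

/-- The resolvent identity. -/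
theorem resolv_identity {A : X →ₗ.[ℂ] X} {s β : ℂ} (hs : s ∈ resolvSet A)
    (hβ : β ∈ resolvSet A) (x : X) :
    resolvDom A s x = resolvDom A β x + (β - s) • resolvDom A s (resolv A β x) := by
  apply hs.1.1
  rw [map_add, map_smul, shiftOp_resolvDom hs, shiftOp_resolvDom hs]
  have h : shiftOp A s (resolvDom A β x) =
      shiftOp A β (resolvDom A β x) - (β - s) • (resolvDom A β x : X) := by
    simp only [shiftOp, LinearMap.sub_apply, LinearMap.smul_apply, Submodule.subtype_apply,
      sub_smul]
    abel
  rw [h, shiftOp_resolvDom hβ, resolv_apply]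
  abel

end Resolvents

section RiggedSpaces

variable {X : Type*} [NormedAddCommGroup X] [NormedSpace ℂ X]

/-- The space `X₁`: `D(A)` with the norm `‖x‖₁ = ‖(β I - A) x‖`. -/
def XOne (A : X →ₗ.[ℂ] X) (_β : resolvSet A) : Type _ := A.domain

instance (A : X →ₗ.[ℂ] X) (β : resolvSet A) : AddCommGroup (XOne A β) :=
  inferInstanceAs (AddCommGroup A.domain)

instance (A : X →ₗ.[ℂ] X) (β : resolvSet A) : Module ℂ (XOne A β) :=
  inferInstanceAs (Module ℂ A.domain)

/-- The identity `D(A) → X₁`. -/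
def XOne.of (A : X →ₗ.[ℂ] X) (β : resolvSet A) : A.domain ≃ₗ[ℂ] XOne A β :=
  LinearEquiv.refl ℂ A.domain

instance (A : X →ₗ.[ℂ] X) (β : resolvSet A) : NormedAddCommGroup (XOne A β) :=
  NormedAddCommGroup.induced (XOne A β) X
    ((shiftOp A β).comp (XOne.of A β).symm.toLinearMap)
    (β.2.1.1.comp (XOne.of A β).symm.injective)

instance (A : X →ₗ.[ℂ] X) (β : resolvSet A) : NormedSpace ℂ (XOne A β) :=
  NormedSpace.induced ℂ (XOne A β) X ((shiftOp A β).comp (XOne.of A β).symm.toLinearMap)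

theorem XOne.norm_of (A : X →ₗ.[ℂ] X) (β : resolvSet A) (x : A.domain) :
    ‖XOne.of A β x‖ = ‖shiftOp A β x‖ := rfl

/-- The space `X` with the norm `‖x‖₋₁ = ‖(β I - A)⁻¹ x‖`. -/
def XPre (A : X →ₗ.[ℂ] X) (_β : resolvSet A) : Type _ := X

instance (A : X →ₗ.[ℂ] X) (β : resolvSet A) : AddCommGroup (XPre A β) :=
  inferInstanceAs (AddCommGroup X)

instance (A : X →ₗ.[ℂ] X) (β : resolvSet A) : Module ℂ (XPre A β) :=
  inferInstanceAs (Module ℂ X)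

/-- The identity from `X` to `X` with the norm `‖·‖₋₁`. -/
def XPre.of (A : X →ₗ.[ℂ] X) (β : resolvSet A) : X ≃ₗ[ℂ] XPre A β :=
  LinearEquiv.refl ℂ X

instance (A : X →ₗ.[ℂ] X) (β : resolvSet A) : NormedAddCommGroup (XPre A β) :=
  NormedAddCommGroup.induced (XPre A β) X
    ((resolv A β).toLinearMap.comp (XPre.of A β).symm.toLinearMap)
    ((resolv_injective β.2).comp (XPre.of A β).symm.injective)

instance (A : X →ₗ.[ℂ] X) (β : resolvSet A) : NormedSpace ℂ (XPre A β) :=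
  NormedSpace.induced ℂ (XPre A β) X
    ((resolv A β).toLinearMap.comp (XPre.of A β).symm.toLinearMap)

/-- The extrapolation space `X₋₁`, the completion of `X` for the norm `‖·‖₋₁`. -/
abbrev XNeg (A : X →ₗ.[ℂ] X) (β : resolvSet A) : Type _ := UniformSpace.Completion (XPre A β)

/-- The canonical embedding `X → X₋₁`. -/
def XNeg.incl (A : X →ₗ.[ℂ] X) (β : resolvSet A) : X →ₗ[ℂ] XNeg A β :=
  (UniformSpace.Completion.toComplₗᵢ (𝕜 := ℂ) (E := XPre A β)).toLinearMap.comp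
    (XPre.of A β).toLinearMap

theorem XNeg.norm_incl (A : X →ₗ.[ℂ] X) (β : resolvSet A) (x : X) :
    ‖XNeg.incl A β x‖ = ‖resolv A β x‖ :=
  (UniformSpace.Completion.toComplₗᵢ (𝕜 := ℂ) (E := XPre A β)).norm_map (XPre.of A β x)

theorem XNeg.denseRange_incl (A : X →ₗ.[ℂ] X) (β : resolvSet A) :
    DenseRange (XNeg.incl A β) :=
  UniformSpace.Completion.denseRange_coe (α := XPre A β)

variable [CompleteSpace X]

/-- The extension of `A` to a bounded operator `X → X₋₁`. -/
def extA (A : X →ₗ.[ℂ] X) (β : resolvSet A) : X →L[ℂ] XNeg A β :=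
  ((XNeg.incl A β).comp A.toFun).extendOfNorm A.domain.subtype

theorem extA_apply (T : C0Semigroup X) (β : resolvSet T.generator) (x : T.generator.domain) :
    extA T.generator β x = XNeg.incl T.generator β (T.generator x) := by
  refine LinearMap.extendOfNorm_eq (e := T.generator.domain.subtype) T.dense_domain
    ⟨‖(β : ℂ)‖ * ‖resolv T.generator β‖ + 1, fun x => ?_⟩ x
  have h : resolv T.generator β (T.generator x)
      = (β : ℂ) • resolv T.generator β x - (x : X) := by
    have h1 := congrArg Subtype.val (resolvDom_shiftOp β.2 x)
    rw [← resolv_apply] at h1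
    have h2 : shiftOp T.generator β x = (β : ℂ) • (x : X) - T.generator x := rfl
    rw [h2, map_sub, map_smul] at h1
    rw [eq_sub_iff_add_eq', ← eq_sub_iff_add_eq, h1]
  rw [LinearMap.comp_apply, XNeg.norm_incl]
  change ‖resolv T.generator β (T.generator x)‖ ≤ _ * ‖(x : X)‖
  rw [h]
  calc _ ≤ ‖(β : ℂ) • resolv T.generator β x‖ + ‖(x : X)‖ := norm_sub_le _ _
    _ ≤ ‖(β : ℂ)‖ * (‖resolv T.generator β‖ * ‖(x : X)‖) + ‖(x : X)‖ := by
      rw [norm_smul]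
      gcongr
      exact (resolv T.generator β).le_opNorm x
    _ = _ := by ring

/-- The extension of `(s I - A)⁻¹` to a bounded operator `X₋₁ → X`, for `s ∈ ρ(A)`. -/
def extResolv (A : X →ₗ.[ℂ] X) (β s : resolvSet A) : XNeg A β →L[ℂ] X :=
  (resolv A s).toLinearMap.extendOfNorm (XNeg.incl A β)

theorem extResolv_incl (A : X →ₗ.[ℂ] X) (β s : resolvSet A) (x : X) :
    extResolv A β s (XNeg.incl A β x) = resolv A s x := by
  refine LinearMap.extendOfNorm_eq (XNeg.denseRange_incl A β)
    ⟨1 + ‖(β : ℂ) - s‖ * ‖resolv A s‖, fun x => ?_⟩ x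
  have h := congrArg Subtype.val (resolv_identity s.2 β.2 x)
  rw [XNeg.norm_incl]
  change ‖resolv A s x‖ ≤ _
  rw [resolv_apply, h]
  change ‖resolv A β x + ((β : ℂ) - s) • resolv A s (resolv A β x)‖ ≤ _
  calc _ ≤ ‖resolv A β x‖ + ‖((β : ℂ) - s) • resolv A s (resolv A β x)‖ := norm_add_le _ _
    _ ≤ ‖resolv A β x‖ + ‖(β : ℂ) - s‖ * (‖resolv A s‖ * ‖resolv A β x‖) := by
      rw [norm_smul]
      gcongr
      exact (resolv A s).le_opNorm _
    _ = _ := by ring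

theorem extResolv_eq (A : X →ₗ.[ℂ] X) (β s : resolvSet A) (ξ : XNeg A β) :
    extResolv A β s ξ = extResolv A β β ξ
      + (((β : ℂ) - s) • resolvDom A s (extResolv A β β ξ) : A.domain) := by
  have h : extResolv A β s = extResolv A β β
      + ((β : ℂ) - s) • (resolv A s).comp (extResolv A β β) := by
    refine ContinuousLinearMap.coeFn_injective ((XNeg.denseRange_incl A β).equalizer
      (extResolv A β s).continuous (ContinuousLinearMap.continuous _) (funext fun x => ?_))
    have h := congrArg Subtype.val (resolv_identity s.2 β.2 x)
    simpa [extResolv_incl, resolv_apply] using h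
  rw [h]
  rfl

/-- The extension of `T t` to a bounded operator on `X₋₁`. -/
def C0Semigroup.extOp (T : C0Semigroup X) (β : resolvSet T.generator) (t : ℝ≥0) :
    XNeg T.generator β →L[ℂ] XNeg T.generator β :=
  ((XNeg.incl T.generator β).comp (T.op t).toLinearMap).extendOfNorm (XNeg.incl T.generator β)

theorem C0Semigroup.extOp_incl (T : C0Semigroup X) (β : resolvSet T.generator) (t : ℝ≥0) (x : X) :
    T.extOp β t (XNeg.incl T.generator β x) = XNeg.incl T.generator β (T.op t x) := by
  refine LinearMap.extendOfNorm_eq (XNeg.denseRange_incl _ β) ⟨‖T.op t‖, fun x => ?_⟩ x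
  have h : resolv T.generator β (T.op t x) = T.op t (resolv T.generator β x) := by
    have h1 : shiftOp T.generator β (T.opDomain t (resolvDom T.generator β x)) = T.op t x := by
      have h2 : shiftOp T.generator β (T.opDomain t (resolvDom T.generator β x))
          = T.op t (shiftOp T.generator β (resolvDom T.generator β x)) := by
        change (β : ℂ) • T.op t (resolvDom T.generator β x) - T.generator _ = T.op t
          ((β : ℂ) • (resolvDom T.generator β x : X) - T.generator (resolvDom T.generator β x))
        rw [map_sub, map_smul, ← T.generator_op]
        rfl
      rw [h2, shiftOp_resolvDom β.2]
    rw [← h1, resolv_apply, resolvDom_shiftOp β.2]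
    rfl
  rw [LinearMap.comp_apply, XNeg.norm_incl, XNeg.norm_incl]
  change ‖resolv T.generator β (T.op t x)‖ ≤ _
  rw [h]
  exact (T.op t).le_opNorm _

end RiggedSpaces

section Admissibility

variable {X U Y : Type*} [NormedAddCommGroup X] [NormedSpace ℂ X] [CompleteSpace X]
  [NormedAddCommGroup U] [NormedSpace ℂ U] [NormedAddCommGroup Y] [NormedSpace ℂ Y]

/-- `B ∈ L(U, X₋₁)` is an admissible control operator: for some `τ > 0`, the integral
`∫₀^τ T (τ - s) B u(s) ds`, computed in `X₋₁`, lies in `X` for all `u ∈ L²([0,∞); U)`. -/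
def IsAdmissibleControl (T : C0Semigroup X) (β : resolvSet T.generator)
    (B : U →L[ℂ] XNeg T.generator β) : Prop :=
  ∃ τ : ℝ, 0 < τ ∧ ∀ u : ℝ → U, MemLp u 2 (volume.restrict (Ici 0)) →
    ∫ s in (0 : ℝ)..τ, T.extOp β (τ - s).toNNReal (B (u s)) ∈
      LinearMap.range (XNeg.incl T.generator β)

/-- `C ∈ L(X₁, Y)` is an admissible observation operator: for some `τ > 0` there is `m > 0` with
`∫₀^τ ‖C T t x‖² dt ≤ m ‖x‖²` for all `x ∈ D(A)`. -/
def IsAdmissibleObservation (T : C0Semigroup X) (β : resolvSet T.generator)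
    (C : XOne T.generator β →L[ℂ] Y) : Prop :=
  ∃ τ : ℝ, 0 < τ ∧ ∃ m : ℝ, 0 < m ∧ ∀ x : T.generator.domain,
    ∫ t in (0 : ℝ)..τ, ‖C (XOne.of T.generator β (T.opDomain t.toNNReal x))‖ ^ 2
      ≤ m * ‖(x : X)‖ ^ 2

/-- The relation `y = C_Λ x`, that is `C l (l I - A)⁻¹ x → y` as `l → ∞`, `l` real. -/
def LambdaRel (A : X →ₗ.[ℂ] X) (β : resolvSet A) (C : XOne A β →L[ℂ] Y) (x : X) (y : Y) : Prop :=
  Tendsto (fun l : ℝ => C (XOne.of A β ((l : ℂ) • resolvDom A (l : ℂ) x))) atTop (𝓝 y)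

theorem LambdaRel.add {A : X →ₗ.[ℂ] X} {β : resolvSet A} {C : XOne A β →L[ℂ] Y} {x x' : X}
    {y y' : Y} (h : LambdaRel A β C x y) (h' : LambdaRel A β C x' y') :
    LambdaRel A β C (x + x') (y + y') :=
  (Tendsto.add h h').congr fun l => by simp only [map_add, smul_add]

theorem LambdaRel.smul {A : X →ₗ.[ℂ] X} {β : resolvSet A} {C : XOne A β →L[ℂ] Y} {x : X} {y : Y}
    (h : LambdaRel A β C x y) (c : ℂ) : LambdaRel A β C (c • x) (c • y) :=
  (Tendsto.const_smul h c).congr fun l => by simp only [map_smul, smul_comm c]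

theorem LambdaRel.unique {A : X →ₗ.[ℂ] X} {β : resolvSet A} {C : XOne A β →L[ℂ] Y} {x : X}
    {y y' : Y} (h : LambdaRel A β C x y) (h' : LambdaRel A β C x y') : y = y' :=
  tendsto_nhds_unique h h'

/-- The `Λ`-extension `C_Λ` of `C ∈ L(X₁, Y)`, whose domain is the set of all `x ∈ X` for which
the limit of `C l (l I - A)⁻¹ x` as `l → ∞` exists. -/
def lambdaExt (A : X →ₗ.[ℂ] X) (β : resolvSet A) (C : XOne A β →L[ℂ] Y) : X →ₗ.[ℂ] Y where
  domain :=
    { carrier := {x | ∃ y, LambdaRel A β C x y}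
      add_mem' := fun ⟨_, h⟩ ⟨_, h'⟩ => ⟨_, h.add h'⟩
      zero_mem' := ⟨0, by simp [LambdaRel]⟩
      smul_mem' := fun c _ ⟨_, h⟩ => ⟨_, h.smul c⟩ }
  toFun :=
    { toFun := fun x => Classical.choose x.2
      map_add' := fun x x' => (Classical.choose_spec (x + x').2).unique
        ((Classical.choose_spec x.2).add (Classical.choose_spec x'.2))
      map_smul' := fun c x => (Classical.choose_spec (c • x).2).unique
        ((Classical.choose_spec x.2).smul c) }

theorem lambdaRel_lambdaExt (A : X →ₗ.[ℂ] X) (β : resolvSet A) (C : XOne A β →L[ℂ] Y)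
    (x : (lambdaExt A β C).domain) : LambdaRel A β C x (lambdaExt A β C x) :=
  Classical.choose_spec x.2

end Admissibility

section Nodes

variable {X U Y : Type*} [NormedAddCommGroup X] [NormedSpace ℂ X] [CompleteSpace X]
  [NormedAddCommGroup U] [NormedSpace ℂ U] [NormedAddCommGroup Y] [NormedSpace ℂ Y]

/-- The space `Z = D(A) + (β I - A)⁻¹ B U`. -/
def zSpace (A : X →ₗ.[ℂ] X) (β : resolvSet A) (B : U →L[ℂ] XNeg A β) : Submodule ℂ X :=
  A.domain ⊔ LinearMap.range ((extResolv A β β).comp B).toLinearMap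

/-- The norm of `Z`: the square root of the infimum of `‖x‖₁² + ‖v‖²` over all `x ∈ D(A)` and
`v ∈ U` with `z = x + (β I - A)⁻¹ B v`. -/
def zNorm (A : X →ₗ.[ℂ] X) (β : resolvSet A) (B : U →L[ℂ] XNeg A β) (z : X) : ℝ :=
  √(sInf {r : ℝ | ∃ (x : A.domain) (v : U),
    z = x + extResolv A β β (B v) ∧ r = ‖XOne.of A β x‖ ^ 2 + ‖v‖ ^ 2})

theorem zNorm_le (A : X →ₗ.[ℂ] X) (β : resolvSet A) (B : U →L[ℂ] XNeg A β)
    (x : A.domain) (v : U) :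
    zNorm A β B (x + extResolv A β β (B v)) ≤ ‖XOne.of A β x‖ + ‖v‖ := by
  refine Real.sqrt_le_iff.2 ⟨by positivity, ?_⟩
  have hmem : ‖XOne.of A β x‖ ^ 2 + ‖v‖ ^ 2 ∈ {r : ℝ | ∃ (x' : A.domain) (v' : U),
      (x : X) + extResolv A β β (B v) = x' + extResolv A β β (B v') ∧
        r = ‖XOne.of A β x'‖ ^ 2 + ‖v'‖ ^ 2} := ⟨x, v, rfl, rfl⟩
  refine (csInf_le ⟨0, ?_⟩ hmem).trans ?_
  · rintro r ⟨x, v, -, rfl⟩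
    positivity
  · nlinarith [norm_nonneg (XOne.of A β x), norm_nonneg v]

/-- A compatible system node `(A, B, C, D)` on `(U, X, Y)`, where `A` is the generator of the
semigroup `T`: `B ∈ L(U, X₋₁)`, `D ∈ L(U, Y)`, and `C : D(C) → Y` is an operator with
`Z ⊆ D(C) ⊆ X` whose restriction to `Z` is in `L(Z, Y)`. -/
structure CompatibleSystemNode (T : C0Semigroup X) (β : resolvSet T.generator)
    (U Y : Type*) [NormedAddCommGroup U] [NormedSpace ℂ U]
    [NormedAddCommGroup Y] [NormedSpace ℂ Y] where
  B : U →L[ℂ] XNeg T.generator β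
  C : X →ₗ.[ℂ] Y
  D : U →L[ℂ] Y
  zSpace_le : zSpace T.generator β B ≤ C.domain
  bounded_on_zSpace : ∃ M : ℝ, 0 ≤ M ∧ ∀ z : C.domain, (z : X) ∈ zSpace T.generator β B →
    ‖C z‖ ≤ M * zNorm T.generator β B z

namespace CompatibleSystemNode

variable {T : C0Semigroup X} {β : resolvSet T.generator}

/-- The domain `D(S)` of the system operator: all `(x, u)` with `A x + B u ∈ X`. -/
def sysDomain (N : CompatibleSystemNode T β U Y) : Set (X × U) :=
  {p | extA T.generator β p.1 + N.B p.2 ∈ LinearMap.range (XNeg.incl T.generator β)}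

/-- `(x, u, y)` is a classical solution on `[0, ∞)` of `(x', y) = S (x, u)`, where
`S (x, u) = (A x + B u, C x + D u)`. The first component is an identity in `X ⊆ X₋₁`. -/
structure IsClassicalSolution (N : CompatibleSystemNode T β U Y)
    (x : ℝ → X) (u : ℝ → U) (y : ℝ → Y) : Prop where
  state_C1 : ContDiffOn ℝ 1 x (Ici 0)
  input_continuous : ContinuousOn u (Ici 0)
  output_continuous : ContinuousOn y (Ici 0)
  mem_sysDomain : ∀ t : ℝ, 0 ≤ t → (x t, u t) ∈ N.sysDomain
  state_eq : ∀ t : ℝ, 0 ≤ t → XNeg.incl T.generator β (derivWithin x (Ici 0) t) =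
    extA T.generator β (x t) + N.B (u t)
  output_eq : ∀ t : ℝ, 0 ≤ t → ∃ h : x t ∈ N.C.domain, y t = N.C ⟨x t, h⟩ + N.D (u t)

/-- Well-posedness. (Here `τ > 0` is arbitrary; the estimate for one `τ` gives it for all.) -/
def IsWellPosed (N : CompatibleSystemNode T β U Y) : Prop :=
  ∀ τ : ℝ, 0 < τ → ∃ K : ℝ, 0 < K ∧ ∀ (x : ℝ → X) (u : ℝ → U) (y : ℝ → Y),
    N.IsClassicalSolution x u y →
      ‖x τ‖ ^ 2 + ∫ t in (0 : ℝ)..τ, ‖y t‖ ^ 2 ≤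
        K * (‖x 0‖ ^ 2 + ∫ t in (0 : ℝ)..τ, ‖u t‖ ^ 2)

theorem extResolv_mem_zSpace (N : CompatibleSystemNode T β U Y) (s : resolvSet T.generator)
    (v : U) : extResolv T.generator β s (N.B v) ∈ zSpace T.generator β N.B := by
  rw [extResolv_eq]
  exact add_mem (Submodule.mem_sup_right ⟨v, rfl⟩) (Submodule.mem_sup_left (SetLike.coe_mem _))

/-- `C (s I - A)⁻¹ B + D` as a linear map. -/
def transferLin (N : CompatibleSystemNode T β U Y) (s : resolvSet T.generator) : U →ₗ[ℂ] Y :=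
  N.C.toFun.comp (((extResolv T.generator β s).comp N.B).toLinearMap.codRestrict N.C.domain
    fun v => N.zSpace_le (N.extResolv_mem_zSpace s v)) + N.D.toLinearMap

theorem transferLin_bound (N : CompatibleSystemNode T β U Y) (s : resolvSet T.generator) :
    ∃ K : ℝ, ∀ v : U, ‖N.transferLin s v‖ ≤ K * ‖v‖ := by
  obtain ⟨M, hM0, hM⟩ := N.bounded_on_zSpace
  set R := (extResolv T.generator β β).comp N.B with hR
  set c : ℂ := (β : ℂ) - s with hc
  set P : X →L[ℂ] X := ContinuousLinearMap.id ℂ X + c • resolv T.generator s with hP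
  refine ⟨M * (‖c‖ * ‖P‖ * ‖R‖ + 1) + ‖N.D‖, fun v => ?_⟩
  have h1 := hM ⟨_, N.zSpace_le (N.extResolv_mem_zSpace s v)⟩ (N.extResolv_mem_zSpace s v)
  have h2 : zNorm T.generator β N.B (extResolv T.generator β s (N.B v))
      ≤ ‖c‖ * ‖P‖ * ‖R‖ * ‖v‖ + ‖v‖ := by
    rw [extResolv_eq, add_comm]
    refine (zNorm_le _ _ _ _ v).trans ?_
    gcongr
    have h3 : shiftOp T.generator β (resolvDom T.generator s (R v)) = P (R v) := by
      have h4 := shiftOp_resolvDom s.2 (R v)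
      have h5 : P (R v) = R v + c • (resolvDom T.generator s (R v) : X) := rfl
      rw [h5]
      nth_rewrite 2 [← h4]
      simp only [shiftOp, LinearMap.sub_apply, LinearMap.smul_apply,
        Submodule.subtype_apply, hc, sub_smul]
      abel
    rw [map_smul, norm_smul, XOne.norm_of, mul_assoc, mul_assoc]
    change ‖c‖ * ‖shiftOp T.generator β (resolvDom T.generator s (R v))‖ ≤ _
    rw [h3]
    gcongr
    exact (P.le_opNorm _).trans (by gcongr; exact R.le_opNorm v)
  calc ‖N.transferLin s v‖ ≤ M * (‖c‖ * ‖P‖ * ‖R‖ * ‖v‖ + ‖v‖) + ‖N.D‖ * ‖v‖ :=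
        (norm_add_le _ _).trans (add_le_add (h1.trans (by gcongr)) (N.D.le_opNorm v))
    _ = _ := by ring

/-- The transfer function `G(s) = C (s I - A)⁻¹ B + D`, for `s ∈ ρ(A)`. -/
def transfer (N : CompatibleSystemNode T β U Y) (s : resolvSet T.generator) : U →L[ℂ] Y :=
  (N.transferLin s).mkContinuousOfExistsBound (N.transferLin_bound s)

/-- Strict properness: `‖G(s)‖ → 0` as `Re s → ∞`, uniformly with respect to `Im s`. That is,
`‖G(s)‖ ≤ b(Re s)` on some right half-plane, with `b` continuous, positive and vanishing at
infinity. -/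
def IsStrictlyProper (N : CompatibleSystemNode T β U Y) : Prop :=
  ∃ (α : ℝ) (b : ℝ → ℝ), ContinuousOn b (Ioi α) ∧ (∀ ξ, α < ξ → 0 < b ξ) ∧
    Tendsto b atTop (𝓝 0) ∧
    ∀ s : ℂ, α < s.re → ∃ hs : s ∈ resolvSet T.generator, ‖N.transfer ⟨s, hs⟩‖ ≤ b s.re

end CompatibleSystemNode

end Nodes

/-- A Riesz basis of `X`: the image of the standard orthonormal basis of `ℓ²` under a bounded
operator with a bounded inverse. -/
def IsRieszBasis {ι X : Type*} [DecidableEq ι] [NormedAddCommGroup X] [NormedSpace ℂ X]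
    (φ : ι → X) : Prop :=
  ∃ Q : lp (fun _ : ι => ℂ) 2 ≃L[ℂ] X, ∀ k, φ k = Q (lp.single 2 k 1)

end

/-! In the eigenbasis the system splits into scalar equations x_k' = μ_k x_k + b_k u with output y =
Σ c_k x_k. Admissibility enters only through the boundedness of the coefficients b_k and c_k
(`exists_extCoord_le`, `exists_obsCoeff_le`). Everything else comes from the quadratic growth of the
eigenvalues. With w = √(Im s / a), one has |s - μ_k| ≥ c (1 + |k - w|)² for Re s large, so Σ |s -
μ_k|^(-3/4) is bounded uniformly on a half-plane (`exists_spectralBounds`).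

Strict properness: G(s) = Σ c_k b_k / (s - μ_k). Since |s - μ_k| ≥ Re s / 2, the spare power 1/4
gives Σ |s - μ_k|^(-1) = O((Re s)^(-1/4)) (`sum_inv_le`).

Compatibility: for z in Z the series Σ z_k c_k converges absolutely, and dominated convergence
identifies its sum with C_Λ z (`lambdaRel_tsum`).

Well-posedness: on [0, P], Parseval turns L² bounds into ℓ² bounds at the points s_n = α + 2πin/P.
Integration by parts writes the n-th coefficient of a finite sum of modes as a bounded multiplier
times that of the input, plus the matrix 1/(s_n - μ_k) applied to endpoint values. A Schur test
bounds this matrix (`exists_sum_norm_sq_cauchy_le`). Zero input then gives the L² bound for free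
outputs, duality gives the ℓ² bound for the driven state, and that bound controls the endpoint
values in the driven case. All bounds are uniform in the finite set of modes, so Fatou's lemma
passes to the full output. -/

set_option linter.unusedSectionVars false

/-! ### Shift-uniform lattice sums. -/

section LatticeSums

/-- Sums of `(1 + |n - w|) ^ (-q)` over sets of integers are bounded uniformly in the shift `w`. -/
theorem exists_sum_one_add_abs_sub_rpow_le {q : ℝ} (hq : 1 < q) :
    ∃ K : ℝ, 0 < K ∧ ∀ (w : ℝ) (F : Finset ℤ), ∑ n ∈ F, (1 + |(n : ℝ) - w|) ^ (-q) ≤ K := by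
  -- The factor 1/2 pays for replacing the real shift w by ⌊w⌋, since 1 + |n - w| ≥ (1 + |n - ⌊w⌋|)
  -- / 2.
  have hs : Summable fun n : ℤ => ((1 / 2 : ℝ) * (1 + |(n : ℝ)|)) ^ (-q) := by
    have h0 : Summable fun n : ℤ => (2 : ℝ) ^ q * |(n : ℝ)| ^ (-q) :=
      (Real.summable_abs_int_rpow hq).mul_left _
    have hcof : ∀ᶠ n : ℤ in cofinite, n ≠ 0 := eventually_cofinite_ne 0
    refine Summable.of_norm_bounded_eventually h0 ?_
    filter_upwards [hcof] with n hn
    have hn' : 0 < |(n : ℝ)| := by positivity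
    rw [Real.norm_of_nonneg (by positivity), Real.mul_rpow (by norm_num) (by positivity)]
    have h2 : ((1 / 2 : ℝ)) ^ (-q) = 2 ^ q := by
      rw [one_div, Real.inv_rpow (by norm_num), Real.rpow_neg (by norm_num), inv_inv]
    rw [h2]
    gcongr ?_ * ?_
    exact Real.rpow_le_rpow_of_nonpos hn' (by linarith) (by linarith)
  refine ⟨∑' n : ℤ, ((1 / 2 : ℝ) * (1 + |(n : ℝ)|)) ^ (-q) + 1, ?_, fun w F => ?_⟩
  · have : 0 ≤ ∑' n : ℤ, ((1 / 2 : ℝ) * (1 + |(n : ℝ)|)) ^ (-q) :=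
      tsum_nonneg fun n => by positivity
    linarith
  · have hinj : Function.Injective fun n : ℤ => n - ⌊w⌋ := sub_left_injective
    have h1 : ∑ n ∈ F, (1 + |(n : ℝ) - w|) ^ (-q)
        ≤ ∑ n ∈ F, ((1 / 2 : ℝ) * (1 + |((n - ⌊w⌋ : ℤ) : ℝ)|)) ^ (-q) := by
      refine Finset.sum_le_sum fun n _ => ?_
      refine Real.rpow_le_rpow_of_nonpos (by positivity) ?_ (by linarith)
      have h3 : |((n - ⌊w⌋ : ℤ) : ℝ)| ≤ |(n : ℝ) - w| + 1 := by
        have h4 : ((n - ⌊w⌋ : ℤ) : ℝ) = ((n : ℝ) - w) + Int.fract w := by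
          push_cast
          rw [Int.fract]
          ring
        rw [h4]
        refine (abs_add_le _ _).trans ?_
        rw [abs_of_nonneg (Int.fract_nonneg w)]
        linarith [Int.fract_lt_one w]
      linarith [abs_nonneg ((n : ℝ) - w)]
    have h2 : ∑ n ∈ F, ((1 / 2 : ℝ) * (1 + |((n - ⌊w⌋ : ℤ) : ℝ)|)) ^ (-q)
        ≤ ∑' n : ℤ, ((1 / 2 : ℝ) * (1 + |(n : ℝ)|)) ^ (-q) := by
      rw [← Finset.sum_image (f := fun n : ℤ => ((1 / 2 : ℝ) * (1 + |(n : ℝ)|)) ^ (-q))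
        (g := fun n : ℤ => n - ⌊w⌋) hinj.injOn]
      exact hs.sum_le_tsum _ fun n _ => by positivity
    linarith

end LatticeSums

/-! ### Separation of the eigenvalues from a half-plane. -/

section Spectrum

/-- Uniform bounds, on the half-plane `α ≤ Re s`, for the numbers `‖s - μ k‖`. -/
structure SpectralBounds {ι : Type*} (μ : ι → ℂ) (M α K : ℝ) : Prop where
  abs_re_le : ∀ k, |(μ k).re| ≤ M
  two_le : 2 ≤ α
  pos : 0 < K
  half_re_le : ∀ s : ℂ, α ≤ s.re → ∀ k, s.re / 2 ≤ ‖s - μ k‖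
  sum_le : ∀ s : ℂ, α ≤ s.re → ∀ F : Finset ι, ∑ k ∈ F, ‖s - μ k‖ ^ (-(3 / 4) : ℝ) ≤ K

/-- Eigenvalues with `μ k = i a k² + O(1)` satisfy spectral bounds. -/
theorem exists_spectralBounds {μ : ℕ+ → ℂ} {a : ℝ} (ha : 0 < a)
    (hμ : ∃ M : ℝ, ∀ k : ℕ+, ‖μ k - Complex.I * (a : ℂ) * (k : ℂ) ^ 2‖ ≤ M) :
    ∃ M α K : ℝ, SpectralBounds μ M α K := by
  obtain ⟨M, hM⟩ := hμ
  have hM0 : 0 ≤ M := (norm_nonneg _).trans (hM 1)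
  -- The quadratic separation turns the exponent 3/4 into 3/2 > 1. Any θ in (1/2, 1) would do in
  -- place of 3/4: 2θ > 1 is needed here, 2 - θ > 1 in the Schur test, and θ < 1 for decay in Re s.
  obtain ⟨K, hK0, hK⟩ := exists_sum_one_add_abs_sub_rpow_le (q := 3 / 2) (by norm_num)
  set c : ℝ := min 1 a / 8 with hc
  have hc0 : 0 < c := by positivity
  have hsq : ∀ k : ℕ+, Complex.I * (a : ℂ) * (k : ℂ) ^ 2
      = ((a * (k : ℝ) ^ 2 : ℝ) : ℂ) * Complex.I := fun k => by push_cast; ring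
  -- The distance d from s to i a k² is at least Re s ≥ 2M + 2, so moving to μ k costs at most M ≤ d
  -- / 2.
  have hhalf : ∀ s : ℂ, 2 * M + 2 ≤ s.re → ∀ k : ℕ+,
      ‖s - Complex.I * (a : ℂ) * (k : ℂ) ^ 2‖ / 2 ≤ ‖s - μ k‖ ∧
      s.re ≤ ‖s - Complex.I * (a : ℂ) * (k : ℂ) ^ 2‖ := by
    intro s hs k
    have h1 : s.re ≤ ‖s - Complex.I * (a : ℂ) * (k : ℂ) ^ 2‖ := by
      have := (Complex.re_le_norm (s - Complex.I * (a : ℂ) * (k : ℂ) ^ 2))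
      rw [hsq] at this ⊢
      simpa [← Complex.ofReal_pow] using this
    have h2 : ‖s - Complex.I * (a : ℂ) * (k : ℂ) ^ 2‖
        ≤ ‖s - μ k‖ + ‖μ k - Complex.I * (a : ℂ) * (k : ℂ) ^ 2‖ := by
      refine le_of_eq_of_le ?_ (norm_add_le _ _)
      congr 1
      ring
    have := hM k
    exact ⟨by linarith, h1⟩
  refine ⟨M, 2 * M + 2, c ^ (-(3 / 4) : ℝ) * K, ?_, by linarith, by positivity, ?_, ?_⟩
  · intro k
    refine le_trans ?_ (hM k)
    have := Complex.abs_re_le_norm (μ k - Complex.I * (a : ℂ) * (k : ℂ) ^ 2)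
    rw [hsq] at this ⊢
    simpa [← Complex.ofReal_pow] using this
  · intro s hs k
    have := hhalf s hs k
    linarith [this.1, this.2]
  · intro s hs F
    -- The real index at which i a w² has the height of s. For Im s < 0 the square root is 0 by
    -- convention, which is the right choice.
    set w : ℝ := √(s.im / a) with hw
    have hw0 : 0 ≤ w := Real.sqrt_nonneg _
    -- Half of d is split into two quarters, bounded below by 1/2 (as d ≥ 2) and by a (k - w)² / 4.
    -- The second bound uses |w² - k²| = |w - k| (w + k) ≥ (k - w)².
    have key : ∀ k : ℕ+, c * (1 + |((k : ℤ) : ℝ) - w|) ^ 2 ≤ ‖s - μ k‖ := by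
      intro k
      obtain ⟨h1, h2⟩ := hhalf s hs k
      have hk0 : (0 : ℝ) < (k : ℝ) := by exact_mod_cast k.pos
      have h3 : |s.im - a * (k : ℝ) ^ 2| ≤ ‖s - Complex.I * (a : ℂ) * (k : ℂ) ^ 2‖ := by
        have := Complex.abs_im_le_norm (s - Complex.I * (a : ℂ) * (k : ℂ) ^ 2)
        rw [hsq] at this ⊢
        simpa [← Complex.ofReal_pow] using this
      have h4 : a * ((k : ℝ) - w) ^ 2 ≤ |s.im - a * (k : ℝ) ^ 2| := by
        rcases le_total 0 s.im with him | him
        · have hws : w ^ 2 = s.im / a := Real.sq_sqrt (by positivity)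
          have h5 : s.im = a * w ^ 2 := by rw [hws]; field_simp
          have h6 : s.im - a * (k : ℝ) ^ 2 = a * ((w - k) * (w + k)) := by rw [h5]; ring
          rw [h6, abs_mul, abs_of_pos ha, abs_mul, abs_of_nonneg (by positivity : 0 ≤ w + k),
            ← sq_abs, abs_sub_comm, sq]
          gcongr
          rw [abs_le]
          constructor <;> linarith
        · have hws : w = 0 := Real.sqrt_eq_zero_of_nonpos (div_nonpos_of_nonpos_of_nonneg him ha.le)
          rw [hws, sub_zero, abs_sub_comm]
          refine le_trans ?_ (le_abs_self _)
          linarith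
      have h7 : ((k : ℤ) : ℝ) = (k : ℝ) := by simp
      rw [h7]
      have h8 : (1 + |(k : ℝ) - w|) ^ 2 ≤ 2 + 2 * ((k : ℝ) - w) ^ 2 := by
        nlinarith [sq_abs ((k : ℝ) - w), sq_nonneg (1 - |(k : ℝ) - w|)]
      have h9 : c ≤ 1 / 8 := by
        rw [hc]; linarith [min_le_left 1 a]
      have h10 : c ≤ a / 8 := by
        rw [hc]; linarith [min_le_right 1 a]
      calc c * (1 + |(k : ℝ) - w|) ^ 2 ≤ c * (2 + 2 * ((k : ℝ) - w) ^ 2) := by gcongr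
        _ = 2 * c + 2 * (c * ((k : ℝ) - w) ^ 2) := by ring
        _ ≤ 2 * (1 / 8) + 2 * (a / 8 * ((k : ℝ) - w) ^ 2) := by gcongr
        _ ≤ _ := by linarith
    have hpow : ∀ k : ℕ+, ‖s - μ k‖ ^ (-(3 / 4) : ℝ)
        ≤ c ^ (-(3 / 4) : ℝ) * (1 + |((k : ℤ) : ℝ) - w|) ^ (-(3 / 2) : ℝ) := by
      intro k
      have h1 : (0 : ℝ) < 1 + |((k : ℤ) : ℝ) - w| := by positivity
      have h2 : (1 + |((k : ℤ) : ℝ) - w|) ^ (-(3 / 2) : ℝ)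
          = ((1 + |((k : ℤ) : ℝ) - w|) ^ 2) ^ (-(3 / 4) : ℝ) := by
        rw [← Real.rpow_natCast, ← Real.rpow_mul h1.le]
        norm_num
      rw [h2, ← Real.mul_rpow hc0.le (by positivity)]
      exact Real.rpow_le_rpow_of_nonpos (by positivity) (key k) (by norm_num)
    have hinj : Function.Injective fun k : ℕ+ => (k : ℤ) := fun k l h => by
      have h : (k : ℤ) = l := h
      exact_mod_cast h
    calc ∑ k ∈ F, ‖s - μ k‖ ^ (-(3 / 4) : ℝ)
        ≤ ∑ k ∈ F, c ^ (-(3 / 4) : ℝ) * (1 + |((k : ℤ) : ℝ) - w|) ^ (-(3 / 2) : ℝ) :=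
          Finset.sum_le_sum fun k _ => hpow k
      _ = c ^ (-(3 / 4) : ℝ) * ∑ n ∈ F.image (fun k : ℕ+ => (k : ℤ)),
            (1 + |(n : ℝ) - w|) ^ (-(3 / 2) : ℝ) := by
          rw [← Finset.mul_sum, Finset.sum_image hinj.injOn]
      _ ≤ _ := by
          gcongr
          exact hK w _

namespace SpectralBounds

variable {ι : Type*} {μ : ι → ℂ} {M α K : ℝ}

theorem one_le_norm (h : SpectralBounds μ M α K) {s : ℂ} (hs : α ≤ s.re) (k : ι) :
    1 ≤ ‖s - μ k‖ := by
  have := h.half_re_le s hs k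
  linarith [h.two_le]

theorem sub_ne_zero (h : SpectralBounds μ M α K) {s : ℂ} (hs : α ≤ s.re) (k : ι) :
    s - μ k ≠ 0 :=
  norm_pos_iff.1 (one_pos.trans_le (h.one_le_norm hs k))

/-- Of the exponent -1, the part -3/4 is spent on summability and the part -1/4 is traded for decay
in Re s. This decay is what yields strict properness. -/
theorem sum_inv_le (h : SpectralBounds μ M α K) {s : ℂ} (hs : α ≤ s.re) (F : Finset ι) :
    ∑ k ∈ F, ‖s - μ k‖⁻¹ ≤ K * (s.re / 2) ^ (-(1 / 4) : ℝ) := by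
  have hre : 0 < s.re / 2 := by linarith [h.two_le]
  calc ∑ k ∈ F, ‖s - μ k‖⁻¹
      ≤ ∑ k ∈ F, ‖s - μ k‖ ^ (-(3 / 4) : ℝ) * (s.re / 2) ^ (-(1 / 4) : ℝ) := by
        refine Finset.sum_le_sum fun k _ => ?_
        have h0 := hre.trans_le (h.half_re_le s hs k)
        have h1 : ‖s - μ k‖⁻¹ = ‖s - μ k‖ ^ (-(3 / 4) : ℝ) * ‖s - μ k‖ ^ (-(1 / 4) : ℝ) := by
          rw [← Real.rpow_add h0, ← Real.rpow_neg_one]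
          norm_num
        rw [h1]
        gcongr ?_ * ?_
        exact Real.rpow_le_rpow_of_nonpos hre (h.half_re_le s hs k) (by norm_num)
    _ = (∑ k ∈ F, ‖s - μ k‖ ^ (-(3 / 4) : ℝ)) * (s.re / 2) ^ (-(1 / 4) : ℝ) := by
        rw [Finset.sum_mul]
    _ ≤ _ := by
        gcongr
        exact h.sum_le s hs F

theorem sum_inv_le' (h : SpectralBounds μ M α K) {s : ℂ} (hs : α ≤ s.re) (F : Finset ι) :
    ∑ k ∈ F, ‖s - μ k‖⁻¹ ≤ K := by
  refine (h.sum_inv_le hs F).trans (mul_le_of_le_one_right h.pos.le ?_)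
  exact Real.rpow_le_one_of_one_le_of_nonpos (by linarith [h.two_le]) (by norm_num)

theorem summable_inv (h : SpectralBounds μ M α K) {s : ℂ} (hs : α ≤ s.re) :
    Summable fun k => ‖s - μ k‖⁻¹ :=
  summable_of_sum_le (fun _ => by positivity) (h.sum_inv_le' hs)

end SpectralBounds

end Spectrum

/-! ### Sampling on a vertical line, Schur test and Parseval. -/

section FourierSchur

/-- The sampling points `α + 2 π i n / P`. -/
noncomputable def samplePoint (α P : ℝ) (n : ℤ) : ℂ := α + ((2 * Real.pi * n / P : ℝ) : ℂ) * Complex.I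

@[simp] theorem samplePoint_re (α P : ℝ) (n : ℤ) : (samplePoint α P n).re = α := by
  simp only [samplePoint, Complex.add_re, Complex.ofReal_re, Complex.re_ofReal_mul, Complex.I_re,
    mul_zero, add_zero]

@[simp] theorem samplePoint_im (α P : ℝ) (n : ℤ) :
    (samplePoint α P n).im = 2 * Real.pi * n / P := by
  simp only [samplePoint, Complex.add_im, Complex.ofReal_im, Complex.im_ofReal_mul, Complex.I_im,
    mul_one, zero_add]

/-- For fixed k the sample points are equally spaced on a line at distance at least 1 from μ k, so
distances grow linearly in n and any exponent above 1 is summable. The choice 5/4 = 2 - 3/4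
complements the row sums in the Schur test. -/
theorem SpectralBounds.exists_sum_samplePoint_le {ι : Type*} {μ : ι → ℂ} {M α K : ℝ}
    (h : SpectralBounds μ M α K) {P : ℝ} (hP : 0 < P) :
    ∃ L : ℝ, 0 < L ∧ ∀ (k : ι) (N : Finset ℤ),
      ∑ n ∈ N, ‖samplePoint α P n - μ k‖ ^ (-(5 / 4) : ℝ) ≤ L := by
  obtain ⟨L, hL0, hL⟩ := exists_sum_one_add_abs_sub_rpow_le (q := 5 / 4) (by norm_num)
  set c : ℝ := min 1 (2 * Real.pi / P) / 2 with hc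
  have hc0 : 0 < c := by have := Real.pi_pos; positivity
  refine ⟨c ^ (-(5 / 4) : ℝ) * L, by positivity, fun k N => ?_⟩
  -- The real index of the point at the height of μ k. The constant c averages the lower bounds 1
  -- and (2π/P) |n - w|.
  set w : ℝ := (μ k).im * P / (2 * Real.pi) with hw
  calc ∑ n ∈ N, ‖samplePoint α P n - μ k‖ ^ (-(5 / 4) : ℝ)
      ≤ ∑ n ∈ N, c ^ (-(5 / 4) : ℝ) * (1 + |(n : ℝ) - w|) ^ (-(5 / 4) : ℝ) := by
        refine Finset.sum_le_sum fun n _ => ?_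
        rw [← Real.mul_rpow hc0.le (by positivity)]
        refine Real.rpow_le_rpow_of_nonpos (by positivity) ?_ (by norm_num)
        have h1 := h.one_le_norm (s := samplePoint α P n) (by simp) k
        have h2 := Complex.abs_im_le_norm (samplePoint α P n - μ k)
        have h3 : (samplePoint α P n - μ k).im = 2 * Real.pi / P * ((n : ℝ) - w) := by
          have := Real.pi_pos
          rw [Complex.sub_im, samplePoint_im, hw]
          field_simp
        have := Real.pi_pos
        rw [h3, abs_mul, abs_of_pos (by positivity)] at h2
        have h4 : c ≤ 1 / 2 := by rw [hc]; linarith [min_le_left 1 (2 * Real.pi / P)]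
        have h5 : c ≤ 2 * Real.pi / P / 2 := by
          rw [hc]; linarith [min_le_right 1 (2 * Real.pi / P)]
        calc c * (1 + |(n : ℝ) - w|) = c + c * |(n : ℝ) - w| := by ring
          _ ≤ 1 / 2 + 2 * Real.pi / P / 2 * |(n : ℝ) - w| := by gcongr
          _ ≤ _ := by linarith
    _ = c ^ (-(5 / 4) : ℝ) * ∑ n ∈ N, (1 + |(n : ℝ) - w|) ^ (-(5 / 4) : ℝ) := by
        rw [Finset.mul_sum]
    _ ≤ _ := by
        gcongr
        exact hL w N

/-- The matrix `(1 / (s n - μ k))` is bounded from `ℓ²` to `ℓ²`. -/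
theorem SpectralBounds.exists_sum_norm_sq_cauchy_le {ι : Type*} {μ : ι → ℂ} {M α K : ℝ}
    (h : SpectralBounds μ M α K) {P : ℝ} (hP : 0 < P) :
    ∃ L : ℝ, 0 < L ∧ ∀ (d : ι → ℂ) (F : Finset ι) (N : Finset ℤ),
      ∑ n ∈ N, ‖∑ k ∈ F, d k / (samplePoint α P n - μ k)‖ ^ 2 ≤ L * ∑ k ∈ F, ‖d k‖ ^ 2 := by
  obtain ⟨L, hL0, hL⟩ := h.exists_sum_samplePoint_le hP
  have hK := h.pos
  refine ⟨K * L, by positivity, fun d F N => ?_⟩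
  set r : ℤ → ι → ℝ := fun n k => ‖samplePoint α P n - μ k‖ with hr
  have hr1 : ∀ n k, 1 ≤ r n k := fun n k => h.one_le_norm (by simp) k
  have hr0 : ∀ n k, 0 < r n k := fun n k => one_pos.trans_le (hr1 n k)
  -- Cauchy–Schwarz with 1/r = r^(-3/8) r^(-5/8): the first factor squares to the bounded row sum
  -- over k, the second to a weight whose column sum over n is bounded.
  have hrow : ∀ n, ‖∑ k ∈ F, d k / (samplePoint α P n - μ k)‖ ^ 2
      ≤ K * ∑ k ∈ F, ‖d k‖ ^ 2 * r n k ^ (-(5 / 4) : ℝ) := by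
    intro n
    calc ‖∑ k ∈ F, d k / (samplePoint α P n - μ k)‖ ^ 2
        ≤ (∑ k ∈ F, r n k ^ (-(3 / 8) : ℝ) * (‖d k‖ * r n k ^ (-(5 / 8) : ℝ))) ^ 2 := by
          gcongr
          refine (norm_sum_le _ _).trans (Finset.sum_le_sum fun k _ => le_of_eq ?_)
          have h1 : (r n k)⁻¹ = r n k ^ (-(3 / 8) : ℝ) * r n k ^ (-(5 / 8) : ℝ) := by
            rw [← Real.rpow_add (hr0 n k), ← Real.rpow_neg_one]
            norm_num
          rw [norm_div, div_eq_mul_inv]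
          change ‖d k‖ * (r n k)⁻¹ = _
          rw [h1]
          ring
      _ ≤ (∑ k ∈ F, (r n k ^ (-(3 / 8) : ℝ)) ^ 2) *
          ∑ k ∈ F, (‖d k‖ * r n k ^ (-(5 / 8) : ℝ)) ^ 2 := Finset.sum_mul_sq_le_sq_mul_sq _ _ _
      _ = (∑ k ∈ F, r n k ^ (-(3 / 4) : ℝ)) *
          ∑ k ∈ F, ‖d k‖ ^ 2 * r n k ^ (-(5 / 4) : ℝ) := by
          have h2 : ∀ k, (r n k ^ (-(3 / 8) : ℝ)) ^ 2 = r n k ^ (-(3 / 4) : ℝ) := fun k => by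
            rw [← Real.rpow_natCast, ← Real.rpow_mul (hr0 n k).le]
            norm_num
          have h3 : ∀ k, (r n k ^ (-(5 / 8) : ℝ)) ^ 2 = r n k ^ (-(5 / 4) : ℝ) := fun k => by
            rw [← Real.rpow_natCast, ← Real.rpow_mul (hr0 n k).le]
            norm_num
          simp only [mul_pow, h2, h3]
      _ ≤ _ := by
          have := fun k => (hr0 n k).le
          gcongr
          exact h.sum_le _ (by simp) F
  calc _ ≤ ∑ n ∈ N, K * ∑ k ∈ F, ‖d k‖ ^ 2 * r n k ^ (-(5 / 4) : ℝ) :=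
        Finset.sum_le_sum fun n _ => hrow n
    _ = K * ∑ k ∈ F, ‖d k‖ ^ 2 * ∑ n ∈ N, r n k ^ (-(5 / 4) : ℝ) := by
        rw [← Finset.mul_sum, Finset.sum_comm]
        simp only [Finset.mul_sum]
    _ ≤ K * ∑ k ∈ F, ‖d k‖ ^ 2 * L := by
        gcongr with k
        exact hL k N
    _ = _ := by rw [← Finset.sum_mul]; ring

theorem Continuous.memLp_restrict_Icc {E : Type*} [NormedAddCommGroup E] {f : ℝ → E}
    (hf : Continuous f) (p : ENNReal) (a b : ℝ) : MemLp f p (volume.restrict (Icc a b)) := by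
  obtain ⟨C, hC⟩ := isCompact_Icc.exists_bound_of_continuousOn (s := Icc a b) hf.continuousOn
  refine MemLp.of_bound (hf.continuousOn.aestronglyMeasurable measurableSet_Icc) C ?_
  exact (ae_restrict_iff' measurableSet_Icc).2 (ae_of_all _ hC)

/-- Parseval's identity for `exp (-α t) g t` on `[0, P]`. -/
theorem hasSum_norm_sq_integral_samplePoint (α : ℝ) {P : ℝ} (hP : 0 < P) {g : ℝ → ℂ}
    (hg : Continuous g) :
    HasSum (fun n : ℤ => ‖∫ t in (0 : ℝ)..P, Complex.exp (-samplePoint α P n * t) * g t‖ ^ 2)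
      (P * ∫ t in (0 : ℝ)..P, ‖Complex.exp (-α * t) * g t‖ ^ 2) := by
  set f : ℝ → ℂ := fun t => Complex.exp (-α * t) * g t with hf
  have hfc : Continuous f := by fun_prop
  have hmem : MemLp f 2 (volume.restrict (Ioc 0 P)) :=
    MemLp.mono_measure (Measure.restrict_mono Ioc_subset_Icc_self le_rfl)
      (hfc.memLp_restrict_Icc 2 0 P)
  have h1 := (hasSum_sq_fourierCoeffOn hP hmem).mul_left (P ^ 2)
  -- Each integral is P times the n-th Fourier coefficient of exp(-αt) g(t) on [0, P].
  have e1 : (fun n : ℤ => ‖∫ t in (0 : ℝ)..P, Complex.exp (-samplePoint α P n * t) * g t‖ ^ 2)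
      = fun n => P ^ 2 * ‖fourierCoeffOn hP f n‖ ^ 2 := by
    funext n
    rw [fourierCoeffOn_eq_integral, norm_smul, mul_pow, sub_zero, Real.norm_of_nonneg (by positivity),
      ← mul_assoc, ← mul_pow, mul_one_div_cancel hP.ne', one_pow, one_mul]
    congr 3
    funext t
    rw [hf, fourier_coe_apply, smul_eq_mul, ← mul_assoc, ← Complex.exp_add]
    congr 2
    simp only [samplePoint]
    push_cast
    have : (P : ℂ) ≠ 0 := by exact_mod_cast hP.ne'
    field_simp
    ring
  have e2 : P * ∫ t in (0 : ℝ)..P, ‖Complex.exp (-α * t) * g t‖ ^ 2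
      = P ^ 2 * (P - 0)⁻¹ • ∫ t in (0 : ℝ)..P, ‖f t‖ ^ 2 := by
    rw [smul_eq_mul, sub_zero, ← mul_assoc]
    congr 1
    field_simp
  rw [e1, e2]
  exact h1

/-- Parseval controls the damped function exp(-αt) g(t); the factor exp(2αP) removes the damping on
[0, P]. -/
theorem integral_norm_sq_le_of_forall_sum_le (α : ℝ) {P : ℝ} (hP : 0 < P) {g : ℝ → ℂ}
    (hg : Continuous g) (hα : 0 ≤ α) {R : ℝ}
    (hR : ∀ N : Finset ℤ,
      ∑ n ∈ N, ‖∫ t in (0 : ℝ)..P, Complex.exp (-samplePoint α P n * t) * g t‖ ^ 2 ≤ R) :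
    ∫ t in (0 : ℝ)..P, ‖g t‖ ^ 2 ≤ Real.exp (2 * α * P) / P * R := by
  have h1 : P * ∫ t in (0 : ℝ)..P, ‖Complex.exp (-α * t) * g t‖ ^ 2 ≤ R :=
    hasSum_le_of_sum_le (hasSum_norm_sq_integral_samplePoint α hP hg) hR
  have h2 : ∫ t in (0 : ℝ)..P, ‖g t‖ ^ 2
      ≤ ∫ t in (0 : ℝ)..P, Real.exp (2 * α * P) * ‖Complex.exp (-α * t) * g t‖ ^ 2 := by
    refine intervalIntegral.integral_mono_on hP.le ?_ ?_ fun t ht => ?_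
    · exact Continuous.intervalIntegrable (by fun_prop) _ _
    · exact Continuous.intervalIntegrable (by fun_prop) _ _
    · rw [norm_mul, mul_pow, ← mul_assoc, Complex.norm_exp, ← Real.exp_nat_mul, ← Real.exp_add]
      refine le_mul_of_one_le_left (by positivity) (Real.one_le_exp ?_)
      have h3 : ((-α * t : ℂ)).re = -(α * t) := by
        rw [← Complex.ofReal_neg, ← Complex.ofReal_mul, Complex.ofReal_re]
        ring
      rw [h3]
      push_cast
      nlinarith [ht.2, ht.1]
  rw [intervalIntegral.integral_const_mul] at h2
  refine h2.trans ?_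
  rw [div_mul_eq_mul_div, le_div_iff₀ hP]
  calc _ = Real.exp (2 * α * P) * (P * ∫ t in (0 : ℝ)..P, ‖Complex.exp (-α * t) * g t‖ ^ 2) := by
        ring
    _ ≤ _ := by gcongr

theorem sum_norm_sq_integral_samplePoint_le {α : ℝ} {P : ℝ} (hP : 0 < P) {g : ℝ → ℂ}
    (hg : Continuous g) (hα : 0 ≤ α) (N : Finset ℤ) :
    ∑ n ∈ N, ‖∫ t in (0 : ℝ)..P, Complex.exp (-samplePoint α P n * t) * g t‖ ^ 2
      ≤ P * ∫ t in (0 : ℝ)..P, ‖g t‖ ^ 2 := by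
  refine (sum_le_hasSum N (fun _ _ => by positivity)
    (hasSum_norm_sq_integral_samplePoint α hP hg)).trans ?_
  gcongr
  refine intervalIntegral.integral_mono_on hP.le ?_ ?_ fun t ht => ?_
  · exact Continuous.intervalIntegrable (by fun_prop) _ _
  · exact Continuous.intervalIntegrable (by fun_prop) _ _
  · rw [norm_mul]
    gcongr
    refine mul_le_of_le_one_left (norm_nonneg _) ?_
    rw [Complex.norm_exp, Real.exp_le_one_iff]
    have h3 : ((-α * t : ℂ)).re = -(α * t) := by
      rw [← Complex.ofReal_neg, ← Complex.ofReal_mul, Complex.ofReal_re]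
      ring
    rw [h3]
    nlinarith [ht.1]

end FourierSchur

/-! ### Uniform energy estimates for finite sums of scalar modes. -/

section ScalarModes

/-- The solution at time `t` of `w' = μ w + f`, `w 0 = 0`. -/
noncomputable def modeResponse (μ : ℂ) (f : ℝ → ℂ) (t : ℝ) : ℂ :=
  Complex.exp (μ * t) * ∫ s in (0 : ℝ)..t, Complex.exp (-μ * s) * f s

@[simp] theorem modeResponse_zero (μ : ℂ) (f : ℝ → ℂ) : modeResponse μ f 0 = 0 := by
  simp [modeResponse]

theorem hasDerivAt_cexp_mul_ofReal (c : ℂ) (t : ℝ) :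
    HasDerivAt (fun t : ℝ => Complex.exp (c * t)) (c * Complex.exp (c * t)) t := by
  have h := ((hasDerivAt_id t).ofReal_comp.const_mul c).cexp
  simpa [mul_comm] using h

theorem hasDerivAt_modeResponse (μ : ℂ) {f : ℝ → ℂ} (hf : Continuous f) (t : ℝ) :
    HasDerivAt (modeResponse μ f) (μ * modeResponse μ f t + f t) t := by
  have hc : Continuous fun s : ℝ => Complex.exp (-μ * s) * f s := by fun_prop
  have h1 : HasDerivAt (fun t => ∫ s in (0 : ℝ)..t, Complex.exp (-μ * s) * f s)
      (Complex.exp (-μ * t) * f t) t :=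
    intervalIntegral.integral_hasDerivAt_right (hc.intervalIntegrable _ _)
      (hc.stronglyMeasurableAtFilter _ _) hc.continuousAt
  refine ((hasDerivAt_cexp_mul_ofReal μ t).mul h1).congr_deriv ?_
  rw [← mul_assoc (Complex.exp (μ * t)), ← Complex.exp_add, modeResponse]
  simp [mul_assoc]

theorem continuous_modeResponse (μ : ℂ) {f : ℝ → ℂ} (hf : Continuous f) :
    Continuous (modeResponse μ f) :=
  continuous_iff_continuousAt.2 fun t => (hasDerivAt_modeResponse μ hf t).continuousAt

theorem modeResponse_eq_integral (μ : ℂ) (f : ℝ → ℂ) (t : ℝ) :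
    modeResponse μ f t = ∫ s in (0 : ℝ)..t, Complex.exp (μ * ((t - s : ℝ) : ℂ)) * f s := by
  rw [modeResponse, ← intervalIntegral.integral_const_mul]
  congr 1
  funext s
  rw [← mul_assoc, ← Complex.exp_add]
  congr 2
  push_cast
  ring

/-- Integration by parts for `z' = μ z + f` against `exp (-s t)`. -/
theorem sub_mul_integral_exp_mul {μ s : ℂ} {z f : ℝ → ℂ} {P : ℝ} (hf : Continuous f)
    (hz : ∀ t, HasDerivAt z (μ * z t + f t) t) :
    (s - μ) * ∫ t in (0 : ℝ)..P, Complex.exp (-s * t) * z t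
      = (∫ t in (0 : ℝ)..P, Complex.exp (-s * t) * f t) + (z 0 - Complex.exp (-s * P) * z P) := by
  have hzc : Continuous z := continuous_iff_continuousAt.2 fun t => (hz t).continuousAt
  have hd : ∀ t : ℝ, HasDerivAt (fun t : ℝ => Complex.exp (-s * t) * z t)
      (Complex.exp (-s * t) * f t - (s - μ) * (Complex.exp (-s * t) * z t)) t := fun t =>
    ((hasDerivAt_cexp_mul_ofReal (-s) t).mul (hz t)).congr_deriv (by ring)
  have h1 := intervalIntegral.integral_eq_sub_of_hasDerivAt (a := 0) (b := P) (fun t _ => hd t)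
    (Continuous.intervalIntegrable (by fun_prop) _ _)
  rw [intervalIntegral.integral_sub (Continuous.intervalIntegrable (by fun_prop) _ _)
    (Continuous.intervalIntegrable (by fun_prop) _ _),
    intervalIntegral.integral_const_mul] at h1
  simp only [Complex.ofReal_zero, mul_zero, Complex.exp_zero, one_mul] at h1
  linear_combination -h1

/-- The boundary term of the integration by parts therefore does not depend on n, so the Cauchy
matrix acts on one fixed sequence of endpoint data. -/
theorem exp_neg_samplePoint_mul (α : ℝ) (P : ℝ) (n : ℤ) (hP : 0 < P) :
    Complex.exp (-samplePoint α P n * P) = Complex.exp (-α * P) := by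
  have hP' : (P : ℂ) ≠ 0 := by exact_mod_cast hP.ne'
  rw [samplePoint, Complex.exp_eq_exp_iff_exists_int]
  refine ⟨-n, ?_⟩
  push_cast
  field_simp
  ring

theorem norm_add_sq_le_two_mul {E : Type*} [SeminormedAddCommGroup E] (x y : E) :
    ‖x + y‖ ^ 2 ≤ 2 * ‖x‖ ^ 2 + 2 * ‖y‖ ^ 2 := by
  have := norm_add_le x y
  nlinarith [norm_nonneg (x + y), sq_nonneg (‖x‖ - ‖y‖), norm_nonneg x, norm_nonneg y]

variable {ι : Type*} {μ : ι → ℂ} {M α K : ℝ}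

/-- Energy estimate for the sum of finitely many modes driven by the same scalar input. -/
theorem SpectralBounds.exists_integral_sum_modes_le (h : SpectralBounds μ M α K) {P : ℝ}
    (hP : 0 < P) {Γ : ℝ} (hΓ : 0 ≤ Γ) :
    ∃ L : ℝ, 0 < L ∧ ∀ (F : Finset ι) (γ : ι → ℂ) (f : ℝ → ℂ) (z : ι → ℝ → ℂ), Continuous f →
      (∀ k, ‖γ k‖ ≤ Γ) → (∀ k t, HasDerivAt (z k) (μ k * z k t + γ k * f t) t) →
      ∫ t in (0 : ℝ)..P, ‖∑ k ∈ F, z k t‖ ^ 2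
        ≤ L * ((∫ t in (0 : ℝ)..P, ‖f t‖ ^ 2) + ∑ k ∈ F, (‖z k 0‖ ^ 2 + ‖z k P‖ ^ 2)) := by
  obtain ⟨L, hL0, hL⟩ := h.exists_sum_norm_sq_cauchy_le hP
  have hα : 0 ≤ α := by linarith [h.two_le]
  have hK := h.pos
  refine ⟨Real.exp (2 * α * P) / P * (2 * (Γ * K) ^ 2 * P + 4 * L), by positivity, ?_⟩
  intro F γ f z hf hγ hz
  set f' : ℤ → ℂ := fun n => ∫ t in (0 : ℝ)..P, Complex.exp (-samplePoint α P n * t) * f t with hf'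
  set d : ι → ℂ := fun k => z k 0 - Complex.exp (-α * P) * z k P with hd
  have hzc : ∀ k, Continuous (z k) := fun k =>
    continuous_iff_continuousAt.2 fun t => (hz k t).continuousAt
  have hexp : ‖Complex.exp (-α * P)‖ ≤ 1 := by
    rw [Complex.norm_exp, Real.exp_le_one_iff, ← Complex.ofReal_neg, ← Complex.ofReal_mul,
      Complex.ofReal_re]
    nlinarith
  have hdk : ∀ k, ‖d k‖ ^ 2 ≤ 2 * (‖z k 0‖ ^ 2 + ‖z k P‖ ^ 2) := fun k => by
    have h1 := norm_add_sq_le_two_mul (z k 0) (-(Complex.exp (-α * P) * z k P))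
    rw [← sub_eq_add_neg, norm_neg, norm_mul, mul_pow] at h1
    have h2 : ‖Complex.exp (-α * P)‖ ^ 2 * ‖z k P‖ ^ 2 ≤ ‖z k P‖ ^ 2 :=
      mul_le_of_le_one_left (by positivity) (pow_le_one₀ (norm_nonneg _) hexp)
    linarith
  -- The multiplier of the input coefficient is a finite-mode transfer function evaluated at the
  -- n-th sample point; the remainder is the Cauchy matrix applied to the endpoint data d.
  have hcoef : ∀ n : ℤ,
      ∫ t in (0 : ℝ)..P, Complex.exp (-samplePoint α P n * t) * ∑ k ∈ F, z k t
        = (∑ k ∈ F, γ k / (samplePoint α P n - μ k)) * f' n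
          + ∑ k ∈ F, d k / (samplePoint α P n - μ k) := by
    intro n
    simp only [Finset.mul_sum]
    rw [intervalIntegral.integral_finsetSum fun k _ =>
      Continuous.intervalIntegrable (by fun_prop) _ _, Finset.sum_mul, ← Finset.sum_add_distrib]
    refine Finset.sum_congr rfl fun k _ => ?_
    have h1 := sub_mul_integral_exp_mul (s := samplePoint α P n) (P := P)
      (f := fun t => γ k * f t) (by fun_prop) (hz k)
    rw [exp_neg_samplePoint_mul α P n hP] at h1
    have h2 : ∫ t in (0 : ℝ)..P, Complex.exp (-samplePoint α P n * t) * (γ k * f t)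
        = γ k * f' n := by
      rw [hf', ← intervalIntegral.integral_const_mul]
      congr 1
      funext t
      ring
    rw [h2] at h1
    have h3 := h.sub_ne_zero (s := samplePoint α P n) (by simp) k
    rw [div_mul_eq_mul_div, ← add_div, eq_div_iff h3, mul_comm]
    exact h1
  have hmul : ∀ n : ℤ, ‖∑ k ∈ F, γ k / (samplePoint α P n - μ k)‖ ≤ Γ * K := by
    intro n
    refine (norm_sum_le _ _).trans ?_
    calc _ ≤ ∑ k ∈ F, Γ * ‖samplePoint α P n - μ k‖⁻¹ := by
          refine Finset.sum_le_sum fun k _ => ?_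
          rw [norm_div, div_eq_mul_inv]
          gcongr
          exact hγ k
      _ = Γ * ∑ k ∈ F, ‖samplePoint α P n - μ k‖⁻¹ := by rw [Finset.mul_sum]
      _ ≤ _ := by
          gcongr
          exact h.sum_inv_le' (by simp) F
  have hcont : Continuous fun t => ∑ k ∈ F, z k t := by fun_prop
  have hI0 : 0 ≤ ∫ t in (0 : ℝ)..P, ‖f t‖ ^ 2 :=
    intervalIntegral.integral_nonneg hP.le fun t _ => by positivity
  have hS0 : 0 ≤ ∑ k ∈ F, (‖z k 0‖ ^ 2 + ‖z k P‖ ^ 2) :=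
    Finset.sum_nonneg fun k _ => by positivity
  rw [mul_assoc]
  refine integral_norm_sq_le_of_forall_sum_le α hP hcont hα fun N => ?_
  calc _ ≤ ∑ n ∈ N, (2 * ((Γ * K) ^ 2 * ‖f' n‖ ^ 2)
        + 2 * ‖∑ k ∈ F, d k / (samplePoint α P n - μ k)‖ ^ 2) := by
        refine Finset.sum_le_sum fun n _ => ?_
        rw [hcoef n]
        refine (norm_add_sq_le_two_mul _ _).trans ?_
        rw [norm_mul, mul_pow]
        gcongr
        exact hmul n
    _ = 2 * (Γ * K) ^ 2 * ∑ n ∈ N, ‖f' n‖ ^ 2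
        + 2 * ∑ n ∈ N, ‖∑ k ∈ F, d k / (samplePoint α P n - μ k)‖ ^ 2 := by
        rw [Finset.sum_add_distrib, ← Finset.mul_sum, ← Finset.mul_sum, ← Finset.mul_sum]
        ring
    _ ≤ 2 * (Γ * K) ^ 2 * (P * ∫ t in (0 : ℝ)..P, ‖f t‖ ^ 2)
        + 2 * (L * ∑ k ∈ F, 2 * (‖z k 0‖ ^ 2 + ‖z k P‖ ^ 2)) := by
        gcongr
        · exact sum_norm_sq_integral_samplePoint_le hP hf hα N
        · refine (hL d F N).trans ?_
          gcongr with k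
          exact hdk k
    _ = 2 * (Γ * K) ^ 2 * P * (∫ t in (0 : ℝ)..P, ‖f t‖ ^ 2)
        + 4 * L * ∑ k ∈ F, (‖z k 0‖ ^ 2 + ‖z k P‖ ^ 2) := by
        rw [← Finset.mul_sum]
        ring
    _ ≤ _ := by
        have h1 : 0 ≤ 2 * (Γ * K) ^ 2 * P := by positivity
        nlinarith [mul_nonneg h1 hS0, mul_nonneg hL0.le hI0]

theorem SpectralBounds.norm_exp_mul_le (h : SpectralBounds μ M α K) (k : ι) {t : ℝ}
    (ht : 0 ≤ t) : ‖Complex.exp (μ k * t)‖ ≤ Real.exp (M * t) := by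
  rw [Complex.norm_exp, Complex.re_mul_ofReal]
  gcongr
  exact (le_abs_self _).trans (h.abs_re_le k)

/-- The energy estimate with zero input: only the endpoint values remain, and |Re μ k| ≤ M bounds
those at P by those at 0. -/
theorem SpectralBounds.exists_integral_sum_exp_le (h : SpectralBounds μ M α K) {P : ℝ}
    (hP : 0 < P) :
    ∃ L : ℝ, 0 < L ∧ ∀ (F : Finset ι) (g : ι → ℂ),
      ∫ t in (0 : ℝ)..P, ‖∑ k ∈ F, g k * Complex.exp (μ k * t)‖ ^ 2
        ≤ L * ∑ k ∈ F, ‖g k‖ ^ 2 := by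
  obtain ⟨L, hL0, hL⟩ := h.exists_integral_sum_modes_le hP le_rfl
  refine ⟨L * (1 + Real.exp (M * P) ^ 2), by positivity, fun F g => ?_⟩
  have h1 := hL F 0 0 (fun k t => g k * Complex.exp (μ k * t)) continuous_zero (by simp)
    fun k t => ((hasDerivAt_cexp_mul_ofReal (μ k) t).const_mul (g k)).congr_deriv (by
      simp only [Pi.zero_apply, mul_zero, add_zero]
      ring)
  refine h1.trans ?_
  rw [mul_assoc]
  gcongr
  simp only [Pi.zero_apply, norm_zero, ne_eq, OfNat.ofNat_ne_zero, not_false_eq_true, zero_pow,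
    intervalIntegral.integral_zero, zero_add, Finset.mul_sum]
  gcongr with k
  rw [norm_mul, mul_pow, norm_mul, mul_pow, Complex.ofReal_zero, mul_zero, Complex.exp_zero,
    norm_one, one_pow, mul_one, add_mul, one_mul, mul_comm (‖g k‖ ^ 2)]
  gcongr
  exact h.norm_exp_mul_le k hP.le

/-- Dual to the estimate for sums of exponentials: the map from f to the final values of the modes
is, up to time reversal, the transpose of the map from coefficients to exponential sums. -/
theorem SpectralBounds.exists_sum_norm_sq_modeResponse_le (h : SpectralBounds μ M α K) {P : ℝ}
    (hP : 0 < P) :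
    ∃ L : ℝ, 0 < L ∧ ∀ (F : Finset ι) (f : ℝ → ℂ), Continuous f →
      ∑ k ∈ F, ‖modeResponse (μ k) f P‖ ^ 2 ≤ L * ∫ t in (0 : ℝ)..P, ‖f t‖ ^ 2 := by
  obtain ⟨L, hL0, hL⟩ := h.exists_integral_sum_exp_le hP
  refine ⟨L, hL0, fun F f hf => ?_⟩
  set W : ι → ℂ := fun k => modeResponse (μ k) f P with hW
  set S : ℝ := ∑ k ∈ F, ‖W k‖ ^ 2 with hS
  -- Testing with the conjugates of the final values makes the pairing of f with the reversed y
  -- equal to S, while ‖y‖² ≤ L S.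
  set y : ℝ → ℂ := fun t => ∑ k ∈ F, star (W k) * Complex.exp (μ k * t) with hy
  have hyc : Continuous y := by fun_prop
  have hyb : ∫ t in (0 : ℝ)..P, ‖y t‖ ^ 2 ≤ L * S := by
    have := hL F fun k => star (W k)
    simpa only [norm_star] using this
  have hSeq : (S : ℂ) = ∫ s in (0 : ℝ)..P, y (P - s) * f s := by
    simp only [hy, Finset.sum_mul]
    rw [intervalIntegral.integral_finsetSum fun k _ =>
      Continuous.intervalIntegrable (by fun_prop) _ _, hS, Complex.ofReal_sum]
    refine Finset.sum_congr rfl fun k _ => ?_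
    simp only [mul_assoc]
    rw [intervalIntegral.integral_const_mul, ← modeResponse_eq_integral]
    change _ = (starRingEnd ℂ) (W k) * W k
    rw [mul_comm, Complex.mul_conj, Complex.normSq_eq_norm_sq]
  -- Young's inequality, weighted so that the y term is at most S / 2 and can be absorbed.
  have hSle : S ≤ ∫ s in (0 : ℝ)..P, ((2 * L)⁻¹ * ‖y (P - s)‖ ^ 2 + L / 2 * ‖f s‖ ^ 2) := by
    calc S ≤ ‖(S : ℂ)‖ := by rw [Complex.norm_real]; exact le_abs_self S
      _ ≤ _ := by
        rw [hSeq]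
        refine intervalIntegral.norm_integral_le_of_norm_le hP.le (ae_of_all _ fun s _ => ?_)
          (Continuous.intervalIntegrable (by fun_prop) _ _)
        rw [norm_mul]
        have h1 := sq_nonneg ((2 * L)⁻¹ * ‖y (P - s)‖ - ‖f s‖ / 2)
        have h2 : (2 * L)⁻¹ * ‖y (P - s)‖ ^ 2 + L / 2 * ‖f s‖ ^ 2
            = ‖y (P - s)‖ * ‖f s‖ + 2 * L * ((2 * L)⁻¹ * ‖y (P - s)‖ - ‖f s‖ / 2) ^ 2 := by
          field_simp
          ring
        rw [h2]
        exact le_add_of_nonneg_right (by positivity)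
  rw [intervalIntegral.integral_add (Continuous.intervalIntegrable (by fun_prop) _ _)
    (Continuous.intervalIntegrable (by fun_prop) _ _), intervalIntegral.integral_const_mul,
    intervalIntegral.integral_const_mul,
    intervalIntegral.integral_comp_sub_left (fun t => ‖y t‖ ^ 2) P, sub_self, sub_zero] at hSle
  have h3 : (2 * L)⁻¹ * ∫ t in (0 : ℝ)..P, ‖y t‖ ^ 2 ≤ (2 * L)⁻¹ * (L * S) := by gcongr
  have h4 : (2 * L)⁻¹ * (L * S) = S / 2 := by field_simp
  linarith

/-- In the energy estimate the initial values vanish, and the final ones are bounded by the input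
through the dual estimate. -/
theorem SpectralBounds.exists_integral_sum_modeResponse_le (h : SpectralBounds μ M α K) {P : ℝ}
    (hP : 0 < P) {Γ : ℝ} (hΓ : 0 ≤ Γ) :
    ∃ L : ℝ, 0 < L ∧ ∀ (F : Finset ι) (γ : ι → ℂ) (f : ℝ → ℂ), Continuous f →
      (∀ k, ‖γ k‖ ≤ Γ) →
      ∫ t in (0 : ℝ)..P, ‖∑ k ∈ F, γ k * modeResponse (μ k) f t‖ ^ 2
        ≤ L * ∫ t in (0 : ℝ)..P, ‖f t‖ ^ 2 := by
  obtain ⟨L₁, hL₁, h₁⟩ := h.exists_integral_sum_modes_le hP hΓ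
  obtain ⟨L₂, hL₂, h₂⟩ := h.exists_sum_norm_sq_modeResponse_le hP
  refine ⟨L₁ * (1 + Γ ^ 2 * L₂), by positivity, fun F γ f hf hγ => ?_⟩
  refine (h₁ F γ f (fun k t => γ k * modeResponse (μ k) f t) hf hγ fun k t => ?_).trans ?_
  · exact ((hasDerivAt_modeResponse (μ k) hf t).const_mul (γ k)).congr_deriv (by ring)
  · rw [mul_assoc, add_mul, one_mul, mul_assoc]
    gcongr
    refine le_trans ?_ (mul_le_mul_of_nonneg_left (h₂ F f hf) (sq_nonneg Γ))
    rw [Finset.mul_sum]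
    gcongr with k
    rw [modeResponse_zero, mul_zero, norm_zero, norm_mul, mul_pow]
    have := hγ k
    norm_num
    gcongr

end ScalarModes

/-! ### Coordinates in a Riesz basis. -/

section RieszCoordinates

variable {ι X Y : Type*} [DecidableEq ι] [NormedAddCommGroup X] [NormedSpace ℂ X]
  [NormedAddCommGroup Y] [NormedSpace ℂ Y]

/-- The basis vectors of the Riesz basis given by `Q`. -/
noncomputable def rieszVec (Q : lp (fun _ : ι => ℂ) 2 ≃L[ℂ] X) (k : ι) : X := Q (lp.single 2 k 1)

/-- The coordinate functionals of the Riesz basis given by `Q`. -/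
noncomputable def rieszCoord (Q : lp (fun _ : ι => ℂ) 2 ≃L[ℂ] X) (k : ι) : X →L[ℂ] ℂ :=
  (lp.evalCLM ℂ (fun _ : ι => ℂ) 2 k).comp (Q.symm : X →L[ℂ] lp (fun _ : ι => ℂ) 2)

variable (Q : lp (fun _ : ι => ℂ) 2 ≃L[ℂ] X)

theorem rieszCoord_apply (k : ι) (x : X) : rieszCoord Q k x = Q.symm x k := rfl

theorem rieszCoord_rieszVec (k j : ι) :
    rieszCoord Q k (rieszVec Q j) = if k = j then 1 else 0 := by
  rw [rieszCoord_apply, rieszVec, Q.symm_apply_apply, lp.single_apply, Pi.single_apply]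

theorem hasSum_rieszCoord_smul (x : X) :
    HasSum (fun k => rieszCoord Q k x • rieszVec Q k) x := by
  have h := (lp.hasSum_single (by simp) (Q.symm x)).mapL (Q : lp (fun _ : ι => ℂ) 2 →L[ℂ] X)
  simp only [ContinuousLinearEquiv.coe_coe, Q.apply_symm_apply] at h
  refine h.congr_fun fun k => ?_
  rw [rieszCoord_apply, rieszVec, ← map_smul, ← lp.single_smul, smul_eq_mul, mul_one]

variable {Q}

theorem rieszCoord_ext {x y : X} (h : ∀ k, rieszCoord Q k x = rieszCoord Q k y) : x = y := by
  have : Q.symm x = Q.symm y := lp.ext (funext h)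
  exact Q.symm.injective this

theorem continuousLinearMap_ext_rieszVec {f g : X →L[ℂ] Y}
    (h : ∀ k, f (rieszVec Q k) = g (rieszVec Q k)) : f = g := by
  ext x
  have hf := (hasSum_rieszCoord_smul Q x).mapL f
  have hg := (hasSum_rieszCoord_smul Q x).mapL g
  simp only [map_smul, h] at hf hg
  exact hf.unique hg

variable (Q)

theorem sum_norm_sq_rieszCoord_le (x : X) (F : Finset ι) :
    ∑ k ∈ F, ‖rieszCoord Q k x‖ ^ 2 ≤ (‖(Q.symm : X →L[ℂ] lp (fun _ : ι => ℂ) 2)‖ * ‖x‖) ^ 2 := by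
  have h := lp.sum_rpow_le_norm_rpow (p := 2) (by simp) (Q.symm x) F
  simp only [ENNReal.toReal_ofNat, Real.rpow_ofNat] at h
  refine h.trans ?_
  gcongr
  exact (Q.symm : X →L[ℂ] lp (fun _ : ι => ℂ) 2).le_opNorm x

theorem summable_norm_sq_rieszCoord (x : X) : Summable fun k => ‖rieszCoord Q k x‖ ^ 2 :=
  summable_of_sum_le (fun _ => by positivity) (sum_norm_sq_rieszCoord_le Q x)

theorem norm_sq_le_of_sum_rieszCoord_le {x : X} {R : ℝ}
    (h : ∀ F : Finset ι, ∑ k ∈ F, ‖rieszCoord Q k x‖ ^ 2 ≤ R) :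
    ‖x‖ ^ 2 ≤ ‖(Q : lp (fun _ : ι => ℂ) 2 →L[ℂ] X)‖ ^ 2 * R := by
  have hR : 0 ≤ R := by simpa using h ∅
  have h1 : ‖Q.symm x‖ ≤ √R := by
    refine lp.norm_le_of_forall_sum_le (p := 2) (by simp) (Real.sqrt_nonneg R) fun F => ?_
    simpa only [ENNReal.toReal_ofNat, Real.rpow_ofNat, Real.sq_sqrt hR, rieszCoord_apply] using h F
  have h2 : ‖x‖ ≤ ‖(Q : lp (fun _ : ι => ℂ) 2 →L[ℂ] X)‖ * √R := by
    have := (Q : lp (fun _ : ι => ℂ) 2 →L[ℂ] X).le_opNorm (Q.symm x)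
    rw [ContinuousLinearEquiv.coe_coe, Q.apply_symm_apply] at this
    exact this.trans (by gcongr)
  calc ‖x‖ ^ 2 ≤ (‖(Q : lp (fun _ : ι => ℂ) 2 →L[ℂ] X)‖ * √R) ^ 2 := by gcongr
    _ = _ := by rw [mul_pow, Real.sq_sqrt hR]

theorem exists_rieszCoord_eq {a : ι → ℂ} {R : ℝ} (h : ∀ F : Finset ι, ∑ k ∈ F, ‖a k‖ ^ 2 ≤ R) :
    ∃ x : X, ∀ k, rieszCoord Q k x = a k := by
  have hmem : Memℓp a 2 := memℓp_gen' (C := R) fun F => by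
    simpa only [ENNReal.toReal_ofNat, Real.rpow_ofNat] using h F
  refine ⟨Q ⟨a, hmem⟩, fun k => ?_⟩
  rw [rieszCoord_apply, Q.symm_apply_apply]

end RieszCoordinates

/-! ### Diagonal form of the generator, its resolvent and the observation operator. -/

section Eigenbasis

variable {ι X Y : Type*} [DecidableEq ι] [NormedAddCommGroup X] [NormedSpace ℂ X]
  [NormedAddCommGroup Y] [NormedSpace ℂ Y]

/-- The Riesz basis given by `Q` consists of eigenvectors of `A`, with eigenvalues `μ k`. -/
structure IsEigenbasis (A : X →ₗ.[ℂ] X) (Q : lp (fun _ : ι => ℂ) 2 ≃L[ℂ] X) (μ : ι → ℂ) :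
    Prop where
  mem_domain : ∀ k, rieszVec Q k ∈ A.domain
  apply_eq : ∀ k, A ⟨rieszVec Q k, mem_domain k⟩ = μ k • rieszVec Q k

namespace IsEigenbasis

variable {A : X →ₗ.[ℂ] X} {Q : lp (fun _ : ι => ℂ) 2 ≃L[ℂ] X} {μ : ι → ℂ}

theorem shiftOp_vec (h : IsEigenbasis A Q μ) (s : ℂ) (k : ι) :
    shiftOp A s ⟨rieszVec Q k, h.mem_domain k⟩ = (s - μ k) • rieszVec Q k := by
  rw [sub_smul, ← h.apply_eq]
  rfl

theorem sub_ne_zero (h : IsEigenbasis A Q μ) {s : ℂ} (hs : s ∈ resolvSet A) (k : ι) :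
    s - μ k ≠ 0 := by
  intro h0
  have h1 := h.shiftOp_vec s k
  rw [h0, zero_smul, ← map_zero (shiftOp A s)] at h1
  have h2 : rieszVec Q k = 0 := congrArg Subtype.val (hs.1.1 h1)
  have h3 := rieszCoord_rieszVec Q k k
  simp [h2] at h3

theorem resolvDom_vec (h : IsEigenbasis A Q μ) {s : ℂ} (hs : s ∈ resolvSet A) (k : ι) :
    resolvDom A s (rieszVec Q k) = (s - μ k)⁻¹ • ⟨rieszVec Q k, h.mem_domain k⟩ := by
  apply hs.1.1
  rw [shiftOp_resolvDom hs, map_smul, h.shiftOp_vec, inv_smul_smul₀ (h.sub_ne_zero hs k)]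

theorem coord_resolv (h : IsEigenbasis A Q μ) {s : ℂ} (hs : s ∈ resolvSet A) (k : ι) (x : X) :
    rieszCoord Q k (resolv A s x) = (s - μ k)⁻¹ * rieszCoord Q k x := by
  have : (rieszCoord Q k).comp (resolv A s) = (s - μ k)⁻¹ • rieszCoord Q k := by
    refine continuousLinearMap_ext_rieszVec (Q := Q) fun j => ?_
    rw [ContinuousLinearMap.comp_apply, resolv_apply, h.resolvDom_vec hs]
    change rieszCoord Q k ((s - μ j)⁻¹ • rieszVec Q j) = (s - μ k)⁻¹ * rieszCoord Q k (rieszVec Q j)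
    rw [map_smul, rieszCoord_rieszVec]
    split_ifs with hkj
    · subst hkj
      rfl
    · simp
  exact DFunLike.congr_fun this x

/-- A is unbounded, so its action cannot be read off the basis expansion of x directly. The formula
is obtained for s = β from the bounded resolvent and then shifted. -/
theorem coord_shiftOp (h : IsEigenbasis A Q μ) {β : ℂ} (hβ : β ∈ resolvSet A) (s : ℂ) (k : ι)
    (x : A.domain) : rieszCoord Q k (shiftOp A s x) = (s - μ k) * rieszCoord Q k x := by
  have h1 : rieszCoord Q k (shiftOp A β x) = (β - μ k) * rieszCoord Q k x := by
    have h2 := h.coord_resolv hβ k (shiftOp A β x)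
    rw [resolv_apply, resolvDom_shiftOp hβ] at h2
    rw [h2, mul_inv_cancel_left₀ (h.sub_ne_zero hβ k)]
  have h3 : shiftOp A s x = shiftOp A β x + (s - β) • (x : X) := by
    simp only [shiftOp, LinearMap.sub_apply, LinearMap.smul_apply, Submodule.subtype_apply,
      sub_smul]
    abel
  rw [h3, map_add, map_smul, h1, smul_eq_mul]
  ring

theorem coord_apply (h : IsEigenbasis A Q μ) {β : ℂ} (hβ : β ∈ resolvSet A) (k : ι)
    (x : A.domain) : rieszCoord Q k (A x) = μ k * rieszCoord Q k x := by
  have h1 := h.coord_shiftOp hβ 0 k x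
  have h2 : shiftOp A 0 x = -A x := by
    simp only [shiftOp, zero_smul, zero_sub, LinearMap.neg_apply]
    rfl
  rw [h2, map_neg] at h1
  linear_combination -h1

theorem norm_inv_sub_le (h : IsEigenbasis A Q μ) {s : ℂ} (hs : s ∈ resolvSet A) (k : ι) :
    ‖(s - μ k)⁻¹‖ ≤ ‖resolv A s‖ := by
  have hne : 0 < ‖rieszVec Q k‖ := by
    rw [norm_pos_iff]
    intro h2
    have h3 := rieszCoord_rieszVec Q k k
    simp [h2] at h3
  have h1 := (resolv A s).le_opNorm (rieszVec Q k)
  rw [resolv_apply, h.resolvDom_vec hs] at h1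
  change ‖(s - μ k)⁻¹ • rieszVec Q k‖ ≤ _ at h1
  rw [norm_smul] at h1
  exact le_of_mul_le_mul_right h1 hne

variable {M α K : ℝ}

theorem mem_resolvSet (h : IsEigenbasis A Q μ) (hμ : SpectralBounds μ M α K) {β : ℂ}
    (hβ : β ∈ resolvSet A) {s : ℂ} (hs : α ≤ s.re) : s ∈ resolvSet A := by
  have hone := fun k => hμ.one_le_norm hs k
  have hne := fun k => hμ.sub_ne_zero hs k
  refine ⟨⟨fun x y hxy => ?_, fun y => ?_⟩, ?_⟩
  · refine Subtype.ext (rieszCoord_ext (Q := Q) fun k => ?_)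
    have h1 := congrArg (rieszCoord Q k) hxy
    rw [h.coord_shiftOp hβ, h.coord_shiftOp hβ] at h1
    exact mul_left_cancel₀ (hne k) h1
  -- Here z is to be (β - A) x for the sought solution x of (s - A) x = y. Its multiplier (β -
  -- μ_k)/(s - μ_k) = 1 + (β - s)/(s - μ_k) is bounded because |s - μ_k| ≥ 1, and x = (β - A)⁻¹ z
  -- lies in the domain automatically.
  · obtain ⟨z, hz⟩ := exists_rieszCoord_eq Q
      (a := fun k => (β - μ k) / (s - μ k) * rieszCoord Q k y)
      (R := (1 + ‖β - s‖) ^ 2 * (‖(Q.symm : X →L[ℂ] lp (fun _ : ι => ℂ) 2)‖ * ‖y‖) ^ 2) (by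
        intro F
        refine le_trans ?_ (mul_le_mul_of_nonneg_left (sum_norm_sq_rieszCoord_le Q y F)
          (by positivity))
        rw [Finset.mul_sum]
        gcongr with k
        rw [norm_mul, mul_pow]
        gcongr
        have h1 : (β - μ k) / (s - μ k) = 1 + (β - s) / (s - μ k) := by
          have := hne k
          field_simp
          ring
        rw [h1]
        refine (norm_add_le _ _).trans ?_
        rw [norm_one, norm_div]
        gcongr
        exact div_le_self (norm_nonneg _) (hone k))
    refine ⟨resolvDom A β z, rieszCoord_ext (Q := Q) fun k => ?_⟩
    rw [h.coord_shiftOp hβ, ← resolv_apply, h.coord_resolv hβ, hz]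
    have h1 := h.sub_ne_zero hβ k
    have h2 := hne k
    field_simp
  · refine ⟨‖(Q : lp (fun _ : ι => ℂ) 2 →L[ℂ] X)‖ *
      ‖(Q.symm : X →L[ℂ] lp (fun _ : ι => ℂ) 2)‖, fun x => ?_⟩
    refine abs_le_of_sq_le_sq' ?_ (by positivity) |>.2
    rw [mul_assoc, mul_pow]
    refine norm_sq_le_of_sum_rieszCoord_le Q fun F => ?_
    refine le_trans ?_ (sum_norm_sq_rieszCoord_le Q (shiftOp A s x) F)
    gcongr with k
    rw [h.coord_shiftOp hβ, norm_mul]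
    exact le_mul_of_one_le_left (norm_nonneg _) (hone k)

/-- β may lie outside the half-plane of the spectral bounds. The sum is compared with the one at α,
since the ratio (α - μ_k)/(β - μ_k) is bounded through the resolvent at β. -/
theorem summable_inv_sub (h : IsEigenbasis A Q μ) (hμ : SpectralBounds μ M α K) {β : ℂ}
    (hβ : β ∈ resolvSet A) : Summable fun k => ‖(β - μ k)⁻¹‖ := by
  have h1 := (hμ.summable_inv (s := (α : ℂ)) (by simp)).mul_left
    (1 + ‖(α : ℂ) - β‖ * ‖resolv A β‖)
  refine Summable.of_nonneg_of_le (fun _ => norm_nonneg _) (fun k => ?_) h1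
  have h2 := h.sub_ne_zero hβ k
  have h3 := hμ.sub_ne_zero (s := (α : ℂ)) (by simp) k
  have h4 : (β - μ k)⁻¹ = (1 + (α - β) * (β - μ k)⁻¹) * ((α : ℂ) - μ k)⁻¹ := by
    field_simp
    ring
  rw [h4, norm_mul, norm_inv ((α : ℂ) - μ k)]
  gcongr
  refine (norm_add_le _ _).trans ?_
  rw [norm_one, norm_mul]
  gcongr
  exact h.norm_inv_sub_le hβ k

/-- The value of the observation operator at the basis vectors. -/
noncomputable def obsCoeff (h : IsEigenbasis A Q μ) (β : resolvSet A) (C : XOne A β →L[ℂ] Y)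
    (k : ι) : Y :=
  C (XOne.of A β ⟨rieszVec Q k, h.mem_domain k⟩)

/-- C is not continuous for the norm of X, but C (β - A)⁻¹ is. So (β - A) x is expanded instead of
x, and the factors β - μ_k cancel. -/
theorem hasSum_obsCoeff (h : IsEigenbasis A Q μ) (β : resolvSet A) (C : XOne A β →L[ℂ] Y)
    (x : A.domain) :
    HasSum (fun k => rieszCoord Q k x • h.obsCoeff β C k) (C (XOne.of A β x)) := by
  have hbound : ∀ y : X, ‖(C.toLinearMap.comp ((XOne.of A β).toLinearMap.comp (resolvDom A β))) y‖
      ≤ ‖C‖ * ‖y‖ := fun y => by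
    have h1 := C.le_opNorm (XOne.of A β (resolvDom A β y))
    rwa [XOne.norm_of, shiftOp_resolvDom β.2] at h1
  have h2 := (hasSum_rieszCoord_smul Q (shiftOp A β x)).mapL (LinearMap.mkContinuous _ _ hbound)
  have h3 : LinearMap.mkContinuous _ _ hbound (shiftOp A β x) = C (XOne.of A β x) := by
    change C (XOne.of A β (resolvDom A β (shiftOp A β x))) = _
    rw [resolvDom_shiftOp β.2]
  rw [h3] at h2
  refine h2.congr_fun fun k => ?_
  rw [map_smul]
  change _ = _ • C (XOne.of A β (resolvDom A β (rieszVec Q k)))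
  rw [h.resolvDom_vec β.2, map_smul, map_smul, smul_smul, h.coord_shiftOp β.2, obsCoeff]
  congr 1
  have := h.sub_ne_zero β.2 k
  field_simp

/-- C λ (λ - A)⁻¹ z is the same series with weights λ/(λ - μ_k). These tend to 1 and are bounded by
2, as |λ - μ_k| ≥ λ/2, so dominated convergence applies. -/
theorem lambdaRel_tsum [CompleteSpace Y] (h : IsEigenbasis A Q μ) (hμ : SpectralBounds μ M α K)
    (β : resolvSet A) (C : XOne A β →L[ℂ] Y) {z : X}
    (hz : Summable fun k => ‖rieszCoord Q k z • h.obsCoeff β C k‖) :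
    LambdaRel A β C z (∑' k, rieszCoord Q k z • h.obsCoeff β C k) := by
  unfold LambdaRel
  have hev : ∀ᶠ l : ℝ in atTop, max α 1 ≤ l := eventually_ge_atTop _
  have h1 : Tendsto (fun l : ℝ => ∑' k, ((l : ℂ) / (l - μ k)) • (rieszCoord Q k z •
      h.obsCoeff β C k)) atTop (𝓝 (∑' k, rieszCoord Q k z • h.obsCoeff β C k)) := by
    refine tendsto_tsum_of_dominated_convergence (hz.mul_left 2) (fun k => ?_) ?_
    · have h2 : Tendsto (fun l : ℝ => (l : ℂ) / (l - μ k)) atTop (𝓝 1) := by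
        have h3 : Tendsto (fun l : ℝ => (1 - μ k * ((l⁻¹ : ℝ) : ℂ))⁻¹) atTop (𝓝 (1 - μ k * 0)⁻¹) := by
          refine Tendsto.inv₀ (tendsto_const_nhds.sub (tendsto_const_nhds.mul ?_)) (by simp)
          exact (Complex.continuous_ofReal.tendsto 0).comp tendsto_inv_atTop_zero
        simp only [mul_zero, sub_zero, inv_one] at h3
        refine h3.congr' ?_
        filter_upwards [hev] with l hl
        have hl0 : (l : ℂ) ≠ 0 := by
          have := (le_max_right _ _).trans hl
          exact_mod_cast (by linarith : l ≠ 0)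
        have hl1 := hμ.sub_ne_zero (s := (l : ℂ)) (by simpa using (le_max_left _ _).trans hl) k
        push_cast
        rw [inv_eq_one_div, div_eq_div_iff _ hl1]
        · field_simp
        · intro h4
          apply hl1
          field_simp at h4
          rwa [mul_zero] at h4
      simpa using h2.smul_const (rieszCoord Q k z • h.obsCoeff β C k)
    · filter_upwards [hev] with l hl k
      have hl0 : 0 < l := by linarith [(le_max_right _ _).trans hl]
      have h2 := hμ.half_re_le (l : ℂ) (by simpa using (le_max_left _ _).trans hl) k
      rw [Complex.ofReal_re] at h2
      rw [norm_smul]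
      gcongr
      rw [norm_div, Complex.norm_real, Real.norm_of_nonneg hl0.le, div_le_iff₀ (by linarith)]
      linarith
  refine h1.congr' ?_
  filter_upwards [hev] with l hl
  have hl1 : (l : ℂ) ∈ resolvSet A :=
    h.mem_resolvSet hμ β.2 (by simpa using (le_max_left _ _).trans hl)
  have h2 := h.hasSum_obsCoeff β C ((l : ℂ) • resolvDom A (l : ℂ) z)
  rw [← h2.tsum_eq]
  congr 1
  funext k
  change _ = rieszCoord Q k ((l : ℂ) • resolv A l z) • _
  rw [map_smul, h.coord_resolv hl1, smul_smul, smul_eq_mul, div_eq_mul_inv, mul_assoc]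

end IsEigenbasis

end Eigenbasis

/-! ### Coordinates of the semigroup and of the extrapolation space; admissible coefficients are
bounded. -/

section SemigroupCoordinates

variable {ι X U Y : Type*} [DecidableEq ι] [NormedAddCommGroup X] [NormedSpace ℂ X]
  [NormedAddCommGroup U] [NormedSpace ℂ U] [NormedAddCommGroup Y] [NormedSpace ℂ Y]

theorem DenseRange.apply_eq_of_forall {α β γ : Type*} [TopologicalSpace β] [TopologicalSpace γ]
    [T2Space γ] {e : α → β} (he : DenseRange e) {f g : β → γ} (hf : Continuous f)
    (hg : Continuous g) (h : ∀ a, f (e a) = g (e a)) (b : β) : f b = g b :=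
  congrFun (he.equalizer hf hg (funext h)) b

theorem C0Semigroup.GenRel.hasDerivWithinAt {T : C0Semigroup X} {x y : X} (h : T.GenRel x y)
    {t : ℝ} (ht : 0 ≤ t) :
    HasDerivWithinAt (fun r : ℝ => T.op r.toNNReal x) (T.op t.toNNReal y) (Ici t) t := by
  rw [← hasDerivWithinAt_Ioi_iff_Ici, hasDerivWithinAt_iff_tendsto_slope' self_notMem_Ioi]
  have h1 : Tendsto (fun r : ℝ => (r - t).toNNReal) (𝓝[>] t) (𝓝[>] 0) := by
    refine tendsto_nhdsWithin_iff.2 ⟨?_, ?_⟩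
    · have h2 : Continuous fun r : ℝ => (r - t).toNNReal := by fun_prop
      simpa using (h2.tendsto t).mono_left nhdsWithin_le_nhds
    · filter_upwards [self_mem_nhdsWithin] with r hr
      exact Real.toNNReal_pos.2 (sub_pos.2 hr)
  refine (((h.op t.toNNReal).comp h1)).congr' ?_
  filter_upwards [self_mem_nhdsWithin] with r hr
  have hr' : 0 ≤ r - t := (sub_pos.2 hr).le
  have h3 : r.toNNReal = (r - t).toNNReal + t.toNNReal := by
    rw [← Real.toNNReal_add hr' ht, sub_add_cancel]
  rw [Function.comp_apply, slope_def_module, h3, T.op_add, Real.coe_toNNReal _ hr',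
    ContinuousLinearMap.comp_apply, ← Complex.ofReal_inv, Complex.coe_smul]

namespace IsEigenbasis

variable {T : C0Semigroup X} {Q : lp (fun _ : ι => ℂ) 2 ≃L[ℂ] X} {μ : ι → ℂ}

/-- exp(-μ_k t) T_t φ_k is continuous with right derivative zero, hence constant. The generator
supplies one-sided derivatives only. -/
theorem op_vec (h : IsEigenbasis T.generator Q μ) (k : ι) (t : ℝ≥0) :
    T.op t (rieszVec Q k) = Complex.exp (μ k * (t : ℝ)) • rieszVec Q k := by
  set g : ℝ → X := fun r => Complex.exp (-μ k * r) • T.op r.toNNReal (rieszVec Q k) with hg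
  have hgen := T.genRel_generator ⟨rieszVec Q k, h.mem_domain k⟩
  rw [h.apply_eq] at hgen
  have hcont : Continuous g := by
    have := (T.strongly_continuous (rieszVec Q k)).comp continuous_real_toNNReal
    exact Continuous.smul (by fun_prop) this
  have hd : ∀ r ∈ Ico (0 : ℝ) t, HasDerivWithinAt g 0 (Ici r) r := by
    intro r hr
    refine ((hasDerivAt_cexp_mul_ofReal (-μ k) r).hasDerivWithinAt.smul
      (hgen.hasDerivWithinAt hr.1)).congr_deriv ?_
    rw [map_smul, smul_smul, ← add_smul, mul_comm (-μ k) (Complex.exp _), ← mul_add,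
      add_neg_cancel, mul_zero, zero_smul]
  have h1 := constant_of_has_deriv_right_zero hcont.continuousOn hd t ⟨t.2, le_rfl⟩
  simp only [hg, Real.toNNReal_coe, Complex.ofReal_zero, mul_zero, Complex.exp_zero, one_smul,
    Real.toNNReal_zero, T.op_zero, ContinuousLinearMap.id_apply] at h1
  conv_rhs => rw [← h1]
  rw [smul_smul, ← Complex.exp_add, neg_mul, add_neg_cancel, Complex.exp_zero, one_smul]

theorem coord_op (h : IsEigenbasis T.generator Q μ) (k : ι) (t : ℝ≥0) (x : X) :
    rieszCoord Q k (T.op t x) = Complex.exp (μ k * (t : ℝ)) * rieszCoord Q k x := by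
  have : (rieszCoord Q k).comp (T.op t) = Complex.exp (μ k * (t : ℝ)) • rieszCoord Q k := by
    refine continuousLinearMap_ext_rieszVec (Q := Q) fun j => ?_
    rw [ContinuousLinearMap.comp_apply, h.op_vec, map_smul, smul_apply,
      rieszCoord_rieszVec]
    split_ifs with hkj
    · rw [hkj]
    · simp
  exact DFunLike.congr_fun this x

variable [CompleteSpace X] {β : resolvSet T.generator}

theorem op_resolv (h : IsEigenbasis T.generator Q μ) (t : ℝ≥0) (x : X) :
    resolv T.generator β (T.op t x) = T.op t (resolv T.generator β x) := by
  refine rieszCoord_ext (Q := Q) fun k => ?_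
  rw [h.coord_resolv β.2, h.coord_op, h.coord_op, h.coord_resolv β.2]
  ring

theorem extResolv_extOp (h : IsEigenbasis T.generator Q μ) (t : ℝ≥0) (ξ : XNeg T.generator β) :
    extResolv T.generator β β (T.extOp β t ξ) = T.op t (extResolv T.generator β β ξ) := by
  refine (XNeg.denseRange_incl T.generator β).apply_eq_of_forall
    (f := fun ξ => extResolv T.generator β β (T.extOp β t ξ))
    (g := fun ξ => T.op t (extResolv T.generator β β ξ)) (by fun_prop) (by fun_prop)
    (fun x => ?_) ξ
  rw [T.extOp_incl, extResolv_incl, extResolv_incl, h.op_resolv]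

end IsEigenbasis

/-- On the dense copy of X this is the definition of the norm of X₋₁. Questions in X₋₁ are thereby
transported to X. -/
theorem norm_extResolv_self [CompleteSpace X] (A : X →ₗ.[ℂ] X) (β : resolvSet A) (ξ : XNeg A β) :
    ‖extResolv A β β ξ‖ = ‖ξ‖ := by
  refine (XNeg.denseRange_incl A β).apply_eq_of_forall
    (f := fun ξ => ‖extResolv A β β ξ‖) (g := fun ξ => ‖ξ‖) (by fun_prop) (by fun_prop)
    (fun x => ?_) ξ
  rw [extResolv_incl, XNeg.norm_incl]

/-- The extension to `X₋₁` of the `k`-th coordinate functional of an eigenbasis. -/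
noncomputable def extCoord [CompleteSpace X] (A : X →ₗ.[ℂ] X) (β : resolvSet A)
    (Q : lp (fun _ : ι => ℂ) 2 ≃L[ℂ] X) (μ : ι → ℂ) (k : ι) : XNeg A β →L[ℂ] ℂ :=
  ((β : ℂ) - μ k) • (rieszCoord Q k).comp (extResolv A β β)

theorem extCoord_apply [CompleteSpace X] (A : X →ₗ.[ℂ] X) (β : resolvSet A)
    (Q : lp (fun _ : ι => ℂ) 2 ≃L[ℂ] X) (μ : ι → ℂ) (k : ι) (ξ : XNeg A β) :
    extCoord A β Q μ k ξ = ((β : ℂ) - μ k) * rieszCoord Q k (extResolv A β β ξ) := rfl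

namespace IsEigenbasis

variable [CompleteSpace X] {Q : lp (fun _ : ι => ℂ) 2 ≃L[ℂ] X} {μ : ι → ℂ} {M α K : ℝ}

theorem extCoord_incl {A : X →ₗ.[ℂ] X} (h : IsEigenbasis A Q μ) (β : resolvSet A) (k : ι)
    (x : X) : extCoord A β Q μ k (XNeg.incl A β x) = rieszCoord Q k x := by
  rw [extCoord_apply, extResolv_incl, h.coord_resolv β.2,
    mul_inv_cancel_left₀ (h.sub_ne_zero β.2 k)]

theorem coord_extResolv {A : X →ₗ.[ℂ] X} (h : IsEigenbasis A Q μ) (β s : resolvSet A) (k : ι)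
    (ξ : XNeg A β) :
    rieszCoord Q k (extResolv A β s ξ) = ((s : ℂ) - μ k)⁻¹ * extCoord A β Q μ k ξ := by
  have h1 : extResolv A β s ξ = extResolv A β β ξ
      + ((β : ℂ) - s) • resolv A s (extResolv A β β ξ) := extResolv_eq A β s ξ
  have h2 := h.sub_ne_zero s.2 k
  rw [h1, map_add, map_smul, h.coord_resolv s.2, extCoord_apply, smul_eq_mul]
  field_simp
  ring

variable {T : C0Semigroup X} {β : resolvSet T.generator}

theorem extCoord_extA (h : IsEigenbasis T.generator Q μ) (k : ι) (x : X) :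
    extCoord T.generator β Q μ k (extA T.generator β x) = μ k * rieszCoord Q k x := by
  refine T.dense_domain.apply_eq_of_forall (f := fun x => extCoord T.generator β Q μ k
    (extA T.generator β x)) (g := fun x => μ k * rieszCoord Q k x) (by fun_prop) (by fun_prop)
    (fun x => ?_) x
  simp only [Submodule.subtype_apply]
  rw [extA_apply, h.extCoord_incl, h.coord_apply β.2]

theorem extCoord_extOp (h : IsEigenbasis T.generator Q μ) (k : ι) (t : ℝ≥0)
    (ξ : XNeg T.generator β) : extCoord T.generator β Q μ k (T.extOp β t ξ)
      = Complex.exp (μ k * (t : ℝ)) * extCoord T.generator β Q μ k ξ := by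
  rw [extCoord_apply, h.extResolv_extOp, h.coord_op, extCoord_apply]
  ring

/-- The isometry (β - A)⁻¹ intertwines the two semigroups. Continuity makes the X₋₁-valued integrals
integrable, so that coordinates may be taken under the integral sign. -/
theorem continuous_extOp (h : IsEigenbasis T.generator Q μ) (ξ : XNeg T.generator β) :
    Continuous fun t : ℝ≥0 => T.extOp β t ξ := by
  have hiso : Isometry (extResolv T.generator β β) :=
    AddMonoidHomClass.isometry_of_norm _ (norm_extResolv_self T.generator β)
  rw [hiso.isEmbedding.continuous_iff]
  refine (T.strongly_continuous (extResolv T.generator β β ξ)).congr fun t => ?_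
  rw [Function.comp_apply, h.extResolv_extOp]

/-- The coefficients of an admissible control operator are bounded. -/
theorem exists_extCoord_le (h : IsEigenbasis T.generator Q μ) (hμ : SpectralBounds μ M α K)
    {B : U →L[ℂ] XNeg T.generator β} (hB : IsAdmissibleControl T β B) (v : U) :
    ∃ R : ℝ, ∀ k, ‖extCoord T.generator β Q μ k (B v)‖ ≤ R := by
  obtain ⟨τ, hτ, hadm⟩ := hB
  set b : ι → ℂ := fun k => extCoord T.generator β Q μ k (B v) with hb
  have hexp : ∀ k, ∀ s ∈ Ioc 0 τ, ‖Complex.exp (μ k * ((τ - s : ℝ) : ℂ))‖ ≤ Real.exp (|M| * τ) := by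
    intro k s hs
    refine (hμ.norm_exp_mul_le k (sub_nonneg.2 hs.2)).trans (Real.exp_le_exp.2 ?_)
    exact mul_le_mul (le_abs_self M) (by linarith [hs.1]) (sub_nonneg.2 hs.2) (abs_nonneg M)
  have hint : ∀ k (f : BoundedContinuousFunction ℝ ℂ), IntervalIntegrable
      (fun s : ℝ => Complex.exp (μ k * ((τ - s : ℝ) : ℂ)) * f s * b k) volume 0 τ := fun k f =>
    Continuous.intervalIntegrable (by fun_prop) _ _
  have hbound : ∀ k (f : BoundedContinuousFunction ℝ ℂ),
      ‖∫ s in (0 : ℝ)..τ, Complex.exp (μ k * ((τ - s : ℝ) : ℂ)) * f s * b k‖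
        ≤ (Real.exp (|M| * τ) * ‖b k‖ * τ) * ‖f‖ := by
    intro k f
    have h1 := intervalIntegral.norm_integral_le_of_norm_le_const (a := 0) (b := τ)
      (f := fun s : ℝ => Complex.exp (μ k * ((τ - s : ℝ) : ℂ)) * f s * b k)
      (C := Real.exp (|M| * τ) * ‖f‖ * ‖b k‖) fun s hs => by
        rw [uIoc_of_le hτ.le] at hs
        rw [norm_mul, norm_mul]
        gcongr
        · exact hexp k s hs
        · exact f.norm_coe_le_norm s
    rw [sub_zero, abs_of_pos hτ] at h1
    refine h1.trans (le_of_eq (by ring))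
  -- F k f is the k-th coordinate of the state reached at time τ from rest under the input f v.
  -- Bounded continuous f are enough for the uniform boundedness principle.
  set F : ι → BoundedContinuousFunction ℝ ℂ →L[ℂ] ℂ := fun k =>
    LinearMap.mkContinuous
      { toFun := fun f => ∫ s in (0 : ℝ)..τ, Complex.exp (μ k * ((τ - s : ℝ) : ℂ)) * f s * b k
        map_add' := fun f g => by
          rw [← intervalIntegral.integral_add (hint k f) (hint k g)]
          congr 1
          funext s
          simp only [BoundedContinuousFunction.coe_add, Pi.add_apply]
          ring
        map_smul' := fun c f => by
          rw [RingHom.id_apply, smul_eq_mul, ← intervalIntegral.integral_const_mul]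
          congr 1
          funext s
          simp only [BoundedContinuousFunction.coe_smul, smul_eq_mul]
          ring } _ (hbound k) with hF
  have hFapp : ∀ k f, F k f
      = ∫ s in (0 : ℝ)..τ, Complex.exp (μ k * ((τ - s : ℝ) : ℂ)) * f s * b k := fun _ _ => rfl
  have hpt : ∀ f, ∃ R, ∀ k, ‖F k f‖ ≤ R := by
    intro f
    -- The cut-off is needed because a bounded continuous function need not be square integrable on
    -- the half-line.
    set u : ℝ → U := (Icc 0 τ).indicator fun s => f s • v with hu
    have hmem : MemLp u 2 (volume.restrict (Ici 0)) := by
      rw [hu, memLp_indicator_iff_restrict measurableSet_Icc,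
        Measure.restrict_restrict measurableSet_Icc,
        inter_eq_left.2 (Icc_subset_Ici_self : Icc 0 τ ⊆ Ici 0)]
      exact Continuous.memLp_restrict_Icc (by fun_prop) 2 0 τ
    obtain ⟨x, hx⟩ := hadm u hmem
    have hcongr : ∫ s in (0 : ℝ)..τ, T.extOp β (τ - s).toNNReal (B (u s))
        = ∫ s in (0 : ℝ)..τ, f s • T.extOp β (τ - s).toNNReal (B v) := by
      refine intervalIntegral.integral_congr fun s hs => ?_
      rw [uIcc_of_le hτ.le] at hs
      simp only [hu, indicator_of_mem hs, map_smul]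
    have hcont : Continuous fun s : ℝ => f s • T.extOp β (τ - s).toNNReal (B v) := by
      have h1 : Continuous fun s : ℝ => T.extOp β (τ - s).toNNReal (B v) :=
        (h.continuous_extOp (B v)).comp (by fun_prop)
      exact f.continuous.smul h1
    -- Admissibility places the final state x in X, so for this f its coordinates are bounded
    -- uniformly in k.
    refine ⟨‖(Q.symm : X →L[ℂ] lp (fun _ : ι => ℂ) 2)‖ * ‖x‖, fun k => ?_⟩
    have h2 : F k f = rieszCoord Q k x := by
      rw [← h.extCoord_incl β, hx, hcongr,
        ← ContinuousLinearMap.intervalIntegral_comp_comm _ (hcont.intervalIntegrable _ _), hFapp]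
      refine intervalIntegral.integral_congr fun s hs => ?_
      rw [uIcc_of_le hτ.le] at hs
      simp only [map_smul, smul_eq_mul]
      rw [h.extCoord_extOp, Real.coe_toNNReal _ (sub_nonneg.2 hs.2)]
      ring
    have h3 := sum_norm_sq_rieszCoord_le Q x {k}
    rw [Finset.sum_singleton] at h3
    rw [h2]
    exact abs_le_of_sq_le_sq' h3 (by positivity) |>.2
  obtain ⟨R, hR⟩ := banach_steinhaus hpt
  refine ⟨R / (τ * Real.exp (-(|M| * τ))), fun k => ?_⟩
  -- This unimodular input cancels the phase of exp(μ_k (τ - s)), so F k f is b_k times a positive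
  -- integral bounded below uniformly in k.
  set f : BoundedContinuousFunction ℝ ℂ := BoundedContinuousFunction.ofNormedAddCommGroup
    (fun s : ℝ => Complex.exp (((-((μ k).im * (τ - s)) : ℝ) : ℂ) * Complex.I)) (by fun_prop) 1
    (fun s => by rw [Complex.norm_exp_ofReal_mul_I]) with hf
  have hfn : ‖f‖ ≤ 1 := BoundedContinuousFunction.norm_ofNormedAddCommGroup_le _ zero_le_one _
  have h1 : F k f = ((∫ s in (0 : ℝ)..τ, Real.exp ((μ k).re * (τ - s)) : ℝ) : ℂ) * b k := by
    rw [hFapp, intervalIntegral.integral_mul_const, ← intervalIntegral.integral_ofReal]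
    congr 2
    funext s
    have h2 : f s = Complex.exp (((-((μ k).im * (τ - s)) : ℝ) : ℂ) * Complex.I) := rfl
    rw [h2, ← Complex.exp_add, Complex.ofReal_exp]
    congr 1
    push_cast
    linear_combination (s - τ : ℂ) * Complex.re_add_im (μ k)
  have h2 : τ * Real.exp (-(|M| * τ)) ≤ ∫ s in (0 : ℝ)..τ, Real.exp ((μ k).re * (τ - s)) := by
    calc τ * Real.exp (-(|M| * τ)) = ∫ s in (0 : ℝ)..τ, Real.exp (-(|M| * τ)) := by simp
      _ ≤ _ := by
        refine intervalIntegral.integral_mono_on hτ.le (by simp)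
          (Continuous.intervalIntegrable (by fun_prop) _ _) fun s hs => ?_
        refine Real.exp_le_exp.2 ?_
        have h3 := (abs_le.1 ((hμ.abs_re_le k).trans (le_abs_self M))).1
        nlinarith [hs.1, hs.2, abs_nonneg M]
  have h3 : ‖F k f‖ ≤ R := ((F k).le_of_opNorm_le_of_le (hR k) hfn).trans (by simp)
  rw [h1, norm_mul, Complex.norm_real] at h3
  have hpos : 0 < τ * Real.exp (-(|M| * τ)) := by positivity
  rw [le_div_iff₀' hpos]
  refine le_trans ?_ h3
  gcongr
  exact h2.trans (le_abs_self _)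

/-- The coefficients of an admissible observation operator are bounded. -/
theorem exists_obsCoeff_le (h : IsEigenbasis T.generator Q μ) (hμ : SpectralBounds μ M α K)
    {C : XOne T.generator β →L[ℂ] Y} (hC : IsAdmissibleObservation T β C) :
    ∃ R : ℝ, ∀ k, ‖h.obsCoeff β C k‖ ≤ R := by
  obtain ⟨τ, hτ, m, hm, hadm⟩ := hC
  set L : ℝ := τ * Real.exp (-(|M| * τ)) ^ 2 with hL
  have hpos : 0 < L := by positivity
  refine ⟨√(m * ‖(Q : lp (fun _ : ι => ℂ) 2 →L[ℂ] X)‖ ^ 2 / L), fun k => ?_⟩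
  refine Real.le_sqrt_of_sq_le ?_
  have hφ : ‖rieszVec Q k‖ ≤ ‖(Q : lp (fun _ : ι => ℂ) 2 →L[ℂ] X)‖ := by
    have h1 := (Q : lp (fun _ : ι => ℂ) 2 →L[ℂ] X).le_opNorm (lp.single 2 k 1)
    rwa [lp.norm_single (by simp), norm_one, mul_one] at h1
  -- The admissibility estimate is tested on one eigenvector, where the output is an exponential
  -- times the coefficient.
  have hnorm : ∀ t ∈ Icc 0 τ, ‖C (XOne.of T.generator β (T.opDomain t.toNNReal
      ⟨rieszVec Q k, h.mem_domain k⟩))‖ ^ 2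
        = Real.exp ((μ k).re * t) ^ 2 * ‖h.obsCoeff β C k‖ ^ 2 := by
    intro t ht
    have h1 : T.opDomain t.toNNReal ⟨rieszVec Q k, h.mem_domain k⟩
        = Complex.exp (μ k * t) • ⟨rieszVec Q k, h.mem_domain k⟩ := by
      refine Subtype.ext ?_
      change T.op t.toNNReal (rieszVec Q k) = Complex.exp (μ k * t) • rieszVec Q k
      rw [h.op_vec, Real.coe_toNNReal _ ht.1]
    rw [h1, map_smul, map_smul, norm_smul, mul_pow, Complex.norm_exp, Complex.re_mul_ofReal,
      obsCoeff]
  have h1 := hadm ⟨rieszVec Q k, h.mem_domain k⟩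
  have h2 : L * ‖h.obsCoeff β C k‖ ^ 2 ≤ ∫ t in (0 : ℝ)..τ, ‖C (XOne.of T.generator β
      (T.opDomain t.toNNReal ⟨rieszVec Q k, h.mem_domain k⟩))‖ ^ 2 := by
    rw [intervalIntegral.integral_congr fun t ht => hnorm t (by rwa [uIcc_of_le hτ.le] at ht),
      intervalIntegral.integral_mul_const]
    gcongr
    calc L = ∫ s in (0 : ℝ)..τ, Real.exp (-(|M| * τ)) ^ 2 := by simp [hL]
      _ ≤ _ := by
        refine intervalIntegral.integral_mono_on hτ.le (by simp)
          (Continuous.intervalIntegrable (by fun_prop) _ _) fun s hs => ?_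
        gcongr
        have h3 := (abs_le.1 ((hμ.abs_re_le k).trans (le_abs_self M))).1
        nlinarith [hs.1, hs.2, abs_nonneg M]
  rw [le_div_iff₀' hpos]
  refine (h2.trans h1).trans ?_
  gcongr

end IsEigenbasis

end SemigroupCoordinates

/-! ### The node with the Λ-extension; strict properness. -/

section LambdaNode

variable {ι X U Y : Type*} [DecidableEq ι] [NormedAddCommGroup X] [NormedSpace ℂ X]
  [CompleteSpace X] [NormedAddCommGroup U] [NormedSpace ℂ U] [NormedAddCommGroup Y]
  [NormedSpace ℂ Y] [CompleteSpace Y]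

namespace IsEigenbasis

variable {Q : lp (fun _ : ι => ℂ) 2 ≃L[ℂ] X} {μ : ι → ℂ} {M α K : ℝ}

/-- z_k = (y_k + η_k)/(β - μ_k). The sequence 1/(β - μ_k) is absolutely summable, hence square
summable, so it pairs with the ℓ² sequence y_k as well as with the bounded η_k. The case η = 0
covers D(A); η_k = b_k u covers states of classical solutions. -/
theorem summable_norm_rieszCoord {A : X →ₗ.[ℂ] X} (h : IsEigenbasis A Q μ)
    (hμ : SpectralBounds μ M α K) (β : resolvSet A) {z y : X} {η : ι → ℂ} {R : ℝ}
    (hη : ∀ k, ‖η k‖ ≤ R)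
    (hz : ∀ k, ((β : ℂ) - μ k) * rieszCoord Q k z = rieszCoord Q k y + η k) :
    Summable fun k => ‖rieszCoord Q k z‖ := by
  have h1 := h.summable_inv_sub hμ β.2
  have h2 := ((h1.mul_left (‖resolv A β‖ + R))).add (summable_norm_sq_rieszCoord Q y)
  refine Summable.of_nonneg_of_le (fun _ => norm_nonneg _) (fun k => ?_) h2
  have h3 : rieszCoord Q k z = ((β : ℂ) - μ k)⁻¹ * (rieszCoord Q k y + η k) := by
    rw [← hz, inv_mul_cancel_left₀ (h.sub_ne_zero β.2 k)]
  have h4 := h.norm_inv_sub_le β.2 k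
  rw [h3, norm_mul]
  set r := ‖((β : ℂ) - μ k)⁻¹‖
  have hr : 0 ≤ r := norm_nonneg _
  calc r * ‖rieszCoord Q k y + η k‖ ≤ r * (‖rieszCoord Q k y‖ + R) := by
        gcongr
        exact (norm_add_le _ _).trans (by gcongr; exact hη k)
    _ ≤ (r * r + r * R) + ‖rieszCoord Q k y‖ ^ 2 := by
        nlinarith [sq_nonneg (r - ‖rieszCoord Q k y‖), sq_nonneg r,
          sq_nonneg ‖rieszCoord Q k y‖]
    _ ≤ (‖resolv A β‖ + R) * r + ‖rieszCoord Q k y‖ ^ 2 := by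
        nlinarith [mul_le_mul_of_nonneg_right h4 hr]

theorem summable_smul_obsCoeff {A : X →ₗ.[ℂ] X} (h : IsEigenbasis A Q μ) {β : resolvSet A}
    {C : XOne A β →L[ℂ] Y} {R : ℝ} (hC : ∀ k, ‖h.obsCoeff β C k‖ ≤ R) {z : X}
    (hz : Summable fun k => ‖rieszCoord Q k z‖) :
    Summable fun k => ‖rieszCoord Q k z • h.obsCoeff β C k‖ := by
  refine Summable.of_nonneg_of_le (fun _ => norm_nonneg _) (fun k => ?_) (hz.mul_right R)
  rw [norm_smul]
  gcongr
  exact hC k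

theorem mem_lambdaExt_domain {A : X →ₗ.[ℂ] X} (h : IsEigenbasis A Q μ)
    (hμ : SpectralBounds μ M α K) {β : resolvSet A} {C : XOne A β →L[ℂ] Y} {z : X}
    (hz : Summable fun k => ‖rieszCoord Q k z • h.obsCoeff β C k‖) :
    z ∈ (lambdaExt A β C).domain :=
  ⟨_, h.lambdaRel_tsum hμ β C hz⟩

theorem lambdaExt_eq_tsum {A : X →ₗ.[ℂ] X} (h : IsEigenbasis A Q μ)
    (hμ : SpectralBounds μ M α K) {β : resolvSet A} {C : XOne A β →L[ℂ] Y}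
    (z : (lambdaExt A β C).domain)
    (hz : Summable fun k => ‖rieszCoord Q k (z : X) • h.obsCoeff β C k‖) :
    lambdaExt A β C z = ∑' k, rieszCoord Q k (z : X) • h.obsCoeff β C k :=
  (lambdaRel_lambdaExt A β C z).unique (h.lambdaRel_tsum hμ β C hz)

variable {T : C0Semigroup X} {β : resolvSet T.generator}

theorem exists_norm_extCoord_comp_le [CompleteSpace U] (h : IsEigenbasis T.generator Q μ)
    (hμ : SpectralBounds μ M α K) {B : U →L[ℂ] XNeg T.generator β}
    (hB : IsAdmissibleControl T β B) :
    ∃ R : ℝ, 0 < R ∧ ∀ k v, ‖extCoord T.generator β Q μ k (B v)‖ ≤ R * ‖v‖ := by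
  obtain ⟨R, hR⟩ := banach_steinhaus (g := fun k => (extCoord T.generator β Q μ k).comp B)
    fun v => h.exists_extCoord_le hμ hB v
  refine ⟨max R 1, by positivity, fun k v => ?_⟩
  exact ((extCoord T.generator β Q μ k).comp B).le_of_opNorm_le
    ((hR k).trans (le_max_left _ _)) v

/-- Bounds for the coefficients of the control and observation operators in the eigenbasis. -/
structure CoeffBounds (h : IsEigenbasis T.generator Q μ) (B : U →L[ℂ] XNeg T.generator β)
    (C : XOne T.generator β →L[ℂ] Y) (Mb Mc : ℝ) : Prop where
  pos_left : 0 < Mb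
  pos_right : 0 < Mc
  extCoord_le : ∀ k v, ‖extCoord T.generator β Q μ k (B v)‖ ≤ Mb * ‖v‖
  obsCoeff_le : ∀ k, ‖h.obsCoeff β C k‖ ≤ Mc

variable {h : IsEigenbasis T.generator Q μ} {B : U →L[ℂ] XNeg T.generator β}
  {C : XOne T.generator β →L[ℂ] Y} {Mb Mc : ℝ}

/-- The terms are c_k b_k(v)/(s - μ_k). With s = β this places the range of (β - A)⁻¹B in D(C_Λ);
for general s it bounds the transfer function. -/
theorem CoeffBounds.tsum_extResolv_le (hBC : h.CoeffBounds B C Mb Mc)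
    (hμ : SpectralBounds μ M α K) (s : resolvSet T.generator) (v : U) :
    (Summable fun k => ‖rieszCoord Q k (extResolv T.generator β s (B v)) • h.obsCoeff β C k‖) ∧
    ‖∑' k, rieszCoord Q k (extResolv T.generator β s (B v)) • h.obsCoeff β C k‖
      ≤ Mb * Mc * (∑' k, ‖((s : ℂ) - μ k)⁻¹‖) * ‖v‖ := by
  have hs := (h.summable_inv_sub hμ s.2).mul_left (Mb * Mc * ‖v‖)
  have hle : ∀ k, ‖rieszCoord Q k (extResolv T.generator β s (B v)) • h.obsCoeff β C k‖
      ≤ Mb * Mc * ‖v‖ * ‖((s : ℂ) - μ k)⁻¹‖ := fun k => by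
    rw [h.coord_extResolv, norm_smul, norm_mul]
    have := hBC.pos_left
    calc _ ≤ ‖((s : ℂ) - μ k)⁻¹‖ * (Mb * ‖v‖) * Mc := by
          gcongr
          · exact hBC.extCoord_le k v
          · exact hBC.obsCoeff_le k
      _ = _ := by ring
  refine ⟨Summable.of_nonneg_of_le (fun _ => norm_nonneg _) hle hs, ?_⟩
  refine (tsum_of_norm_bounded hs.hasSum hle).trans (le_of_eq ?_)
  rw [tsum_mul_left]
  ring

theorem CoeffBounds.mem_domain_of_mem_zSpace (hBC : h.CoeffBounds B C Mb Mc)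
    (hμ : SpectralBounds μ M α K) :
    zSpace T.generator β B ≤ (lambdaExt T.generator β C).domain := by
  refine sup_le (fun x hx => ?_) ?_
  · refine ⟨C (XOne.of T.generator β ⟨x, hx⟩), ?_⟩
    have h1 := h.summable_norm_rieszCoord hμ β (z := x) (y := shiftOp T.generator β ⟨x, hx⟩)
      (η := 0) (R := 0) (by simp) fun k => by simp [h.coord_shiftOp β.2]
    have h2 := h.lambdaRel_tsum hμ β C (h.summable_smul_obsCoeff hBC.obsCoeff_le h1)
    rwa [(h.hasSum_obsCoeff β C ⟨x, hx⟩).tsum_eq] at h2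
  · rintro _ ⟨v, rfl⟩
    exact h.mem_lambdaExt_domain hμ (hBC.tsum_extResolv_le hμ β v).1

theorem CoeffBounds.lambdaExt_domain_eq (hBC : h.CoeffBounds B C Mb Mc)
    (hμ : SpectralBounds μ M α K) (x : T.generator.domain)
    (hx : (x : X) ∈ (lambdaExt T.generator β C).domain) :
    lambdaExt T.generator β C ⟨x, hx⟩ = C (XOne.of T.generator β x) := by
  have h1 := h.summable_norm_rieszCoord hμ β (z := x) (y := shiftOp T.generator β x)
    (η := 0) (R := 0) (by simp) fun k => by simp [h.coord_shiftOp β.2]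
  rw [h.lambdaExt_eq_tsum hμ ⟨x, hx⟩ (h.summable_smul_obsCoeff hBC.obsCoeff_le h1)]
  exact (h.hasSum_obsCoeff β C x).tsum_eq

theorem CoeffBounds.exists_lambdaExt_le (hBC : h.CoeffBounds B C Mb Mc)
    (hμ : SpectralBounds μ M α K) :
    ∃ L : ℝ, 0 ≤ L ∧ ∀ z : (lambdaExt T.generator β C).domain,
      (z : X) ∈ zSpace T.generator β B →
        ‖lambdaExt T.generator β C z‖ ≤ L * zNorm T.generator β B z := by
  set R : ℝ := max ‖C‖ (Mb * Mc * ∑' k, ‖((β : ℂ) - μ k)⁻¹‖) + 1 with hR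
  have hR0 : 0 < R := by
    have : 0 ≤ ‖C‖ := norm_nonneg C
    have := this.trans (le_max_left ‖C‖ (Mb * Mc * ∑' k, ‖((β : ℂ) - μ k)⁻¹‖))
    linarith
  -- Every decomposition of z gives the bound R (‖x‖₁ + ‖v‖), and (p + q)² ≤ 4 (p² + q²) turns it
  -- into a bound by the infimum defining `zNorm`.
  refine ⟨2 * R, by positivity, fun z hz => ?_⟩
  have hZ := hBC.mem_domain_of_mem_zSpace hμ
  have key : ∀ (x : T.generator.domain) (v : U), (z : X) = x + extResolv T.generator β β (B v) →
      ‖lambdaExt T.generator β C z‖ ≤ R * (‖XOne.of T.generator β x‖ + ‖v‖) := by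
    intro x v hzx
    have hx : (x : X) ∈ (lambdaExt T.generator β C).domain :=
      hZ (Submodule.mem_sup_left x.2)
    have hv : extResolv T.generator β β (B v) ∈ (lambdaExt T.generator β C).domain :=
      hZ (Submodule.mem_sup_right ⟨v, rfl⟩)
    have h1 : z = ⟨x, hx⟩ + ⟨_, hv⟩ := Subtype.ext hzx
    obtain ⟨h2, h3⟩ := hBC.tsum_extResolv_le hμ β v
    rw [h1, LinearPMap.map_add, hBC.lambdaExt_domain_eq hμ, h.lambdaExt_eq_tsum hμ ⟨_, hv⟩ h2]
    refine (norm_add_le _ _).trans ?_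
    rw [mul_add]
    gcongr
    · refine (C.le_opNorm _).trans ?_
      gcongr
      exact (le_max_left _ _).trans (le_add_of_nonneg_right zero_le_one)
    · refine h3.trans ?_
      gcongr
      exact (le_max_right _ _).trans (le_add_of_nonneg_right zero_le_one)
  have hle : ‖lambdaExt T.generator β C z‖ / (2 * R) ≤ zNorm T.generator β B z := by
    refine Real.le_sqrt_of_sq_le (le_csInf ?_ ?_)
    · obtain ⟨x, hx, _, ⟨v, rfl⟩, hxv⟩ := Submodule.mem_sup.1 hz
      exact ⟨_, ⟨x, hx⟩, v, hxv.symm, rfl⟩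
    · rintro r ⟨x, v, hzx, rfl⟩
      have h1 := key x v hzx
      rw [div_pow, div_le_iff₀ (by positivity)]
      calc ‖lambdaExt T.generator β C z‖ ^ 2
          ≤ (R * (‖XOne.of T.generator β x‖ + ‖v‖)) ^ 2 := by gcongr
        _ ≤ _ := by
          rw [mul_pow, mul_pow, mul_comm (_ + _)]
          have := sq_nonneg (‖XOne.of T.generator β x‖ - ‖v‖)
          nlinarith [sq_nonneg R, mul_nonneg (sq_nonneg R) this, mul_nonneg (sq_nonneg R)
            (sq_nonneg (‖XOne.of T.generator β x‖ + ‖v‖))]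
  rwa [div_le_iff₀' (by positivity)] at hle

/-- The system node `(A, B, C_Λ, 0)`. -/
noncomputable def CoeffBounds.node (hBC : h.CoeffBounds B C Mb Mc)
    (hμ : SpectralBounds μ M α K) : CompatibleSystemNode T β U Y where
  B := B
  C := lambdaExt T.generator β C
  D := 0
  zSpace_le := hBC.mem_domain_of_mem_zSpace hμ
  bounded_on_zSpace := hBC.exists_lambdaExt_le hμ

theorem CoeffBounds.isStrictlyProper (hBC : h.CoeffBounds B C Mb Mc)
    (hμ : SpectralBounds μ M α K) : (hBC.node hμ).IsStrictlyProper := by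
  have hMb := hBC.pos_left
  have hMc := hBC.pos_right
  have hK := hμ.pos
  have hα := hμ.two_le
  refine ⟨α, fun ξ => Mb * Mc * (K * (ξ / 2) ^ (-(1 / 4) : ℝ)), ?_, fun ξ hξ => ?_, ?_,
    fun s hs => ⟨h.mem_resolvSet hμ β.2 hs.le, ?_⟩⟩
  · refine continuousOn_const.mul (continuousOn_const.mul
      (ContinuousOn.rpow_const (by fun_prop) fun ξ hξ => Or.inl ?_))
    have : α < ξ := hξ
    linarith
  · have : 0 < ξ := by linarith
    positivity
  · have h1 := (tendsto_rpow_neg_atTop (by norm_num : (0 : ℝ) < 1 / 4)).comp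
      (tendsto_id.atTop_div_const (by norm_num : (0 : ℝ) < 2))
    simpa using (h1.const_mul K).const_mul (Mb * Mc)
  · have hs' := h.mem_resolvSet hμ β.2 hs.le
    have hre : 0 < s.re := by linarith
    refine ContinuousLinearMap.opNorm_le_bound _ (by positivity) fun v => ?_
    obtain ⟨h2, h3⟩ := hBC.tsum_extResolv_le hμ ⟨s, hs'⟩ v
    have hv : extResolv T.generator β ⟨s, hs'⟩ (B v) ∈ (lambdaExt T.generator β C).domain :=
      h.mem_lambdaExt_domain hμ h2
    have h4 : (hBC.node hμ).transfer ⟨s, hs'⟩ v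
        = lambdaExt T.generator β C ⟨extResolv T.generator β ⟨s, hs'⟩ (B v), hv⟩ := by
      change lambdaExt T.generator β C ⟨extResolv T.generator β ⟨s, hs'⟩ (B v), hv⟩ + 0 = _
      rw [add_zero]
    rw [h4, h.lambdaExt_eq_tsum hμ ⟨_, hv⟩ h2]
    refine h3.trans ?_
    beta_reduce
    gcongr
    simp only [norm_inv]
    exact (hμ.summable_inv hs.le).tsum_le_of_sum_le (hμ.sum_inv_le hs.le)

end IsEigenbasis

end LambdaNode

/-! ### Modes with initial value and several inputs. -/

section MultiInputModes

variable {ι J : Type*} [Fintype J] {μ : ι → ℂ} {M α K : ℝ}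

/-- The solution of `x' = μ x + ∑ j, b j * f j`, `x 0 = ξ`. -/
noncomputable def modeState (μ : ℂ) (b : J → ℂ) (f : J → ℝ → ℂ) (ξ : ℂ) (t : ℝ) : ℂ :=
  ξ * Complex.exp (μ * t) + ∑ j, b j * modeResponse μ (f j) t

theorem hasDerivAt_modeState (μ : ℂ) (b : J → ℂ) {f : J → ℝ → ℂ} (hf : ∀ j, Continuous (f j))
    (ξ : ℂ) (t : ℝ) :
    HasDerivAt (modeState μ b f ξ) (μ * modeState μ b f ξ t + ∑ j, b j * f j t) t := by
  refine (((hasDerivAt_cexp_mul_ofReal μ t).const_mul ξ).add (HasDerivAt.fun_sum fun j _ =>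
    (hasDerivAt_modeResponse μ (hf j) t).const_mul (b j))).congr_deriv ?_
  rw [modeState, mul_add, Finset.mul_sum, add_assoc, ← Finset.sum_add_distrib]
  congr 1
  · ring
  · exact Finset.sum_congr rfl fun j _ => by ring

@[simp] theorem modeState_zero (μ : ℂ) (b : J → ℂ) (f : J → ℝ → ℂ) (ξ : ℂ) :
    modeState μ b f ξ 0 = ξ := by
  simp [modeState]

/-- Uniqueness of solutions of the scalar equation, with one-sided derivatives. -/
theorem eq_modeState {μ : ℂ} {b : J → ℂ} {f : J → ℝ → ℂ} (hf : ∀ j, Continuous (f j))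
    {z : ℝ → ℂ} {P : ℝ} (hzc : ContinuousOn z (Icc 0 P))
    (hz : ∀ t ∈ Ico 0 P, HasDerivWithinAt z (μ * z t + ∑ j, b j * f j t) (Ici t) t)
    {t : ℝ} (ht : t ∈ Icc 0 P) : z t = modeState μ b f (z 0) t := by
  set w := modeState μ b f (z 0) with hw
  have hwd := hasDerivAt_modeState μ b hf (z 0)
  have hwc : Continuous w := continuous_iff_continuousAt.2 fun t => (hwd t).continuousAt
  have hqc : ContinuousOn (fun r : ℝ => Complex.exp (-μ * r) * (z r - w r)) (Icc 0 P) :=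
    ContinuousOn.mul (Continuous.continuousOn (by fun_prop)) (hzc.sub hwc.continuousOn)
  have hqd : ∀ r ∈ Ico 0 P, HasDerivWithinAt
      (fun r : ℝ => Complex.exp (-μ * r) * (z r - w r)) 0 (Ici r) r := fun r hr => by
    refine ((hasDerivAt_cexp_mul_ofReal (-μ) r).hasDerivWithinAt.mul
      ((hz r hr).sub (hwd r).hasDerivWithinAt)).congr_deriv ?_
    simp only [Pi.sub_apply]
    ring
  have h1 := constant_of_has_deriv_right_zero hqc hqd t ht
  simp only [hw, modeState_zero, sub_self, mul_zero, mul_eq_zero, Complex.exp_ne_zero,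
    false_or] at h1
  exact sub_eq_zero.1 h1

theorem norm_add_sum_sq_le {E : Type*} [SeminormedAddCommGroup E] (x : E) (y : J → E) :
    ‖x + ∑ j, y j‖ ^ 2 ≤ 2 * ‖x‖ ^ 2 + 2 * (Fintype.card J * ∑ j, ‖y j‖ ^ 2) := by
  refine (norm_add_sq_le_two_mul _ _).trans ?_
  gcongr
  calc ‖∑ j, y j‖ ^ 2 ≤ (∑ j, ‖y j‖) ^ 2 := by
        gcongr
        exact norm_sum_le _ _
    _ ≤ _ := sq_sum_le_card_mul_sum_sq

theorem SpectralBounds.exists_sum_norm_sq_modeState_le (h : SpectralBounds μ M α K) {P : ℝ}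
    (hP : 0 < P) (Γ : ℝ) :
    ∃ L : ℝ, 0 < L ∧ ∀ (F : Finset ι) (b : ι → J → ℂ) (f : J → ℝ → ℂ) (ξ : ι → ℂ),
      (∀ j, Continuous (f j)) → (∀ k j, ‖b k j‖ ≤ Γ) →
      ∑ k ∈ F, ‖modeState (μ k) (b k) f (ξ k) P‖ ^ 2
        ≤ L * (∑ k ∈ F, ‖ξ k‖ ^ 2 + ∑ j, ∫ t in (0 : ℝ)..P, ‖f j t‖ ^ 2) := by
  obtain ⟨L, hL0, hL⟩ := h.exists_sum_norm_sq_modeResponse_le hP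
  refine ⟨2 * Real.exp (M * P) ^ 2 + 2 * (Fintype.card J * (Γ ^ 2 * L)), by positivity,
    fun F b f ξ hf hb => ?_⟩
  have hI0 : 0 ≤ ∑ j, ∫ t in (0 : ℝ)..P, ‖f j t‖ ^ 2 := Finset.sum_nonneg fun j _ =>
    intervalIntegral.integral_nonneg hP.le fun t _ => by positivity
  have hS0 : 0 ≤ ∑ k ∈ F, ‖ξ k‖ ^ 2 := Finset.sum_nonneg fun k _ => by positivity
  calc _ ≤ ∑ k ∈ F, (2 * (Real.exp (M * P) ^ 2 * ‖ξ k‖ ^ 2)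
        + 2 * (Fintype.card J * ∑ j, Γ ^ 2 * ‖modeResponse (μ k) (f j) P‖ ^ 2)) := by
        refine Finset.sum_le_sum fun k _ => (norm_add_sum_sq_le _ _).trans ?_
        rw [norm_mul, mul_pow, mul_comm (‖ξ k‖ ^ 2)]
        gcongr with j
        · exact h.norm_exp_mul_le k hP.le
        · rw [norm_mul, mul_pow]
          gcongr
          exact hb k j
    _ = 2 * Real.exp (M * P) ^ 2 * ∑ k ∈ F, ‖ξ k‖ ^ 2 + 2 * (Fintype.card J * (Γ ^ 2 *
        ∑ j, ∑ k ∈ F, ‖modeResponse (μ k) (f j) P‖ ^ 2)) := by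
        rw [Finset.sum_add_distrib, ← Finset.mul_sum, ← Finset.mul_sum, ← Finset.mul_sum,
          ← Finset.mul_sum, Finset.sum_comm (s := F), ← mul_assoc]
        simp only [← Finset.mul_sum]
    _ ≤ 2 * Real.exp (M * P) ^ 2 * ∑ k ∈ F, ‖ξ k‖ ^ 2 + 2 * (Fintype.card J * (Γ ^ 2 *
        ∑ j, L * ∫ t in (0 : ℝ)..P, ‖f j t‖ ^ 2)) := by
        gcongr with j
        exact hL F (f j) (hf j)
    _ = 2 * Real.exp (M * P) ^ 2 * ∑ k ∈ F, ‖ξ k‖ ^ 2 + 2 * (Fintype.card J * (Γ ^ 2 * L)) *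
        ∑ j, ∫ t in (0 : ℝ)..P, ‖f j t‖ ^ 2 := by
        rw [← Finset.mul_sum]
        ring
    _ ≤ _ := by
        have h1 : 0 ≤ 2 * Real.exp (M * P) ^ 2 := by positivity
        have h2 : 0 ≤ 2 * (Fintype.card J * (Γ ^ 2 * L)) := by positivity
        nlinarith [mul_nonneg h1 hI0, mul_nonneg h2 hS0]

/-- The output is a free part, an exponential sum in the initial data, plus one driven part for each
scalar input; each is covered by a single-input estimate. -/
theorem SpectralBounds.exists_integral_sum_modeState_le (h : SpectralBounds μ M α K) {P : ℝ}
    (hP : 0 < P) {Γ Δ : ℝ} (hΓ : 0 ≤ Γ) (hΔ : 0 ≤ Δ) :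
    ∃ L : ℝ, 0 < L ∧ ∀ (F : Finset ι) (b : ι → J → ℂ) (c : ι → ℂ) (f : J → ℝ → ℂ) (ξ : ι → ℂ),
      (∀ j, Continuous (f j)) → (∀ k j, ‖b k j‖ ≤ Γ) → (∀ k, ‖c k‖ ≤ Δ) →
      ∫ t in (0 : ℝ)..P, ‖∑ k ∈ F, modeState (μ k) (b k) f (ξ k) t * c k‖ ^ 2
        ≤ L * (∑ k ∈ F, ‖ξ k‖ ^ 2 + ∑ j, ∫ t in (0 : ℝ)..P, ‖f j t‖ ^ 2) := by
  obtain ⟨L₁, hL₁, h₁⟩ := h.exists_integral_sum_exp_le hP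
  obtain ⟨L₂, hL₂, h₂⟩ := h.exists_integral_sum_modeResponse_le hP (mul_nonneg hΓ hΔ)
  -- The `+ 1` keeps the constant positive when Δ = 0 and `J` is empty.
  refine ⟨2 * L₁ * Δ ^ 2 + 2 * (Fintype.card J * L₂) + 1, by positivity,
    fun F b c f ξ hf hb hc => ?_⟩
  have hI0 : 0 ≤ ∑ j, ∫ t in (0 : ℝ)..P, ‖f j t‖ ^ 2 := Finset.sum_nonneg fun j _ =>
    intervalIntegral.integral_nonneg hP.le fun t _ => by positivity
  have hS0 : 0 ≤ ∑ k ∈ F, ‖ξ k‖ ^ 2 := Finset.sum_nonneg fun k _ => by positivity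
  have hmc := fun k j => continuous_modeResponse (μ k) (hf j)
  have hsplit : ∀ t, ∑ k ∈ F, modeState (μ k) (b k) f (ξ k) t * c k
      = (∑ k ∈ F, (ξ k * c k) * Complex.exp (μ k * t))
        + ∑ j, ∑ k ∈ F, (b k j * c k) * modeResponse (μ k) (f j) t := by
    intro t
    rw [Finset.sum_comm, ← Finset.sum_add_distrib]
    refine Finset.sum_congr rfl fun k _ => ?_
    rw [modeState, add_mul, Finset.sum_mul]
    congr 1
    · ring
    · exact Finset.sum_congr rfl fun j _ => by ring
  calc _ ≤ ∫ t in (0 : ℝ)..P, (2 * ‖∑ k ∈ F, (ξ k * c k) * Complex.exp (μ k * t)‖ ^ 2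
        + 2 * (Fintype.card J *
          ∑ j, ‖∑ k ∈ F, (b k j * c k) * modeResponse (μ k) (f j) t‖ ^ 2)) := by
        simp only [hsplit]
        refine intervalIntegral.integral_mono_on hP.le
          (Continuous.intervalIntegrable (by fun_prop) _ _)
          (Continuous.intervalIntegrable (by fun_prop) _ _) fun t _ => norm_add_sum_sq_le _ _
    _ = 2 * (∫ t in (0 : ℝ)..P, ‖∑ k ∈ F, (ξ k * c k) * Complex.exp (μ k * t)‖ ^ 2)
        + 2 * (Fintype.card J * ∑ j, ∫ t in (0 : ℝ)..P,
          ‖∑ k ∈ F, (b k j * c k) * modeResponse (μ k) (f j) t‖ ^ 2) := by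
        rw [intervalIntegral.integral_add (Continuous.intervalIntegrable (by fun_prop) _ _)
          (Continuous.intervalIntegrable (by fun_prop) _ _)]
        rw [intervalIntegral.integral_const_mul, intervalIntegral.integral_const_mul,
          intervalIntegral.integral_const_mul, intervalIntegral.integral_finsetSum fun j _ =>
            Continuous.intervalIntegrable (by fun_prop) _ _]
    _ ≤ 2 * (L₁ * ∑ k ∈ F, ‖ξ k * c k‖ ^ 2)
        + 2 * (Fintype.card J * ∑ j, L₂ * ∫ t in (0 : ℝ)..P, ‖f j t‖ ^ 2) := by
        gcongr with j
        · exact h₁ F _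
        · refine h₂ F (fun k => b k j * c k) (f j) (hf j) fun k => ?_
          rw [norm_mul]
          gcongr
          · exact hb k j
          · exact hc k
    _ ≤ 2 * (L₁ * ∑ k ∈ F, Δ ^ 2 * ‖ξ k‖ ^ 2)
        + 2 * (Fintype.card J * ∑ j, L₂ * ∫ t in (0 : ℝ)..P, ‖f j t‖ ^ 2) := by
        gcongr with k
        rw [norm_mul, mul_pow, mul_comm]
        gcongr
        exact hc k
    _ = 2 * L₁ * Δ ^ 2 * ∑ k ∈ F, ‖ξ k‖ ^ 2
        + 2 * (Fintype.card J * L₂) * ∑ j, ∫ t in (0 : ℝ)..P, ‖f j t‖ ^ 2 := by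
        rw [← Finset.mul_sum, ← Finset.mul_sum]
        ring
    _ ≤ _ := by
        have h1 : 0 ≤ 2 * L₁ * Δ ^ 2 := by positivity
        have h2 : 0 ≤ 2 * (Fintype.card J * L₂) := by positivity
        nlinarith [mul_nonneg h1 hI0, mul_nonneg h2 hS0]

end MultiInputModes

/-! ### Passage from finite partial sums to the full output. -/

section Fatou

/-- Fatou's lemma for squared norms of finite partial sums. -/
theorem integral_norm_sq_le_of_hasSum {ι E : Type*} [Countable ι] [NormedAddCommGroup E]
    {P R : ℝ} (hP : 0 ≤ P) {g : ι → ℝ → E} {y : ℝ → E} (hg : ∀ k, Continuous (g k))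
    (hy : ContinuousOn y (Icc 0 P)) (hsum : ∀ t ∈ Icc 0 P, HasSum (fun k => g k t) (y t))
    (hR : ∀ F : Finset ι, ∫ t in (0 : ℝ)..P, ‖∑ k ∈ F, g k t‖ ^ 2 ≤ R) :
    ∫ t in (0 : ℝ)..P, ‖y t‖ ^ 2 ≤ R := by
  have hR0 : 0 ≤ R :=
    (intervalIntegral.integral_nonneg hP fun t _ => by positivity).trans (hR ∅)
  set ν : Measure ℝ := volume.restrict (Icc 0 P) with hν
  have hyint : Integrable (fun t => ‖y t‖ ^ 2) ν := (hy.norm.pow 2).integrableOn_Icc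
  have hFc : ∀ F : Finset ι, Continuous fun t => ‖∑ k ∈ F, g k t‖ ^ 2 := fun F => by fun_prop
  have hconv : ∀ u : ℝ → ℝ, ∫ t in (0 : ℝ)..P, u t = ∫ t, u t ∂ν := fun u => by
    rw [intervalIntegral.integral_of_le hP, hν, integral_Icc_eq_integral_Ioc]
  rw [hconv, ← ENNReal.ofReal_le_ofReal_iff hR0,
    ofReal_integral_eq_lintegral_ofReal hyint (ae_of_all _ fun t => by positivity)]
  calc ∫⁻ t, ENNReal.ofReal (‖y t‖ ^ 2) ∂ν
      -- Pointwise convergence along finite sets of indices lets Fatou's lemma work with nonnegative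
      -- integrals, without a dominating function.
      = ∫⁻ t, liminf (fun F : Finset ι => ENNReal.ofReal (‖∑ k ∈ F, g k t‖ ^ 2)) atTop ∂ν := by
        refine lintegral_congr_ae ((ae_restrict_iff' measurableSet_Icc).2 (ae_of_all _ fun t ht => ?_))
        have h1 : Tendsto (fun F : Finset ι => ∑ k ∈ F, g k t) atTop (𝓝 (y t)) := hsum t ht
        exact ((ENNReal.continuous_ofReal.tendsto _).comp (h1.norm.pow 2)).liminf_eq.symm
    _ ≤ liminf (fun F : Finset ι => ∫⁻ t, ENNReal.ofReal (‖∑ k ∈ F, g k t‖ ^ 2) ∂ν) atTop :=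
        lintegral_liminf_le' fun F => ((hFc F).measurable.ennreal_ofReal).aemeasurable
    _ ≤ ENNReal.ofReal R := by
        refine liminf_le_of_le ?_ fun b hb => ?_
        · isBoundedDefault
        · obtain ⟨F, hF⟩ := hb.exists
          refine hF.trans ?_
          rw [← ofReal_integral_eq_lintegral_ofReal
            ((hFc F).continuousOn.integrableOn_Icc) (ae_of_all _ fun t => by positivity), ← hconv]
          exact ENNReal.ofReal_le_ofReal (hR F)

theorem integral_norm_sq_euclidean {J : Type*} [Fintype J] {P : ℝ} (hP : 0 ≤ P)
    {u : ℝ → EuclideanSpace ℂ J} (hu : ContinuousOn u (Icc 0 P)) :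
    ∫ t in (0 : ℝ)..P, ‖u t‖ ^ 2 = ∑ j, ∫ t in (0 : ℝ)..P, ‖u t j‖ ^ 2 := by
  simp only [EuclideanSpace.norm_sq_eq]
  refine intervalIntegral.integral_finsetSum fun j _ => ?_
  refine ContinuousOn.intervalIntegrable_of_Icc hP (ContinuousOn.pow (ContinuousOn.norm ?_) 2)
  exact (EuclideanSpace.proj (𝕜 := ℂ) j).continuous.comp_continuousOn hu

end Fatou

/-! ### Classical solutions in coordinates and well-posedness. -/

section WellPosedness

variable {X I J : Type*} [NormedAddCommGroup X] [NormedSpace ℂ X] [CompleteSpace X]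
  [Fintype I] [Fintype J] [DecidableEq J]

namespace IsEigenbasis

variable {ι : Type*} [DecidableEq ι] [Countable ι]
  {Q : lp (fun _ : ι => ℂ) 2 ≃L[ℂ] X} {μ : ι → ℂ} {M α K : ℝ}
  {T : C0Semigroup X} {β : resolvSet T.generator} {h : IsEigenbasis T.generator Q μ}
  {B : EuclideanSpace ℂ J →L[ℂ] XNeg T.generator β}
  {C : XOne T.generator β →L[ℂ] EuclideanSpace ℂ I} {Mb Mc : ℝ}

/-- Extended coordinates applied to the state equation in X₋₁ give a scalar equation for each mode,
whose solution is unique. Replacing r by max(r, 0) extends the input continuously to the whole line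
without changing it for r ≥ 0. -/
theorem CoeffBounds.coord_classicalSolution (hBC : h.CoeffBounds B C Mb Mc)
    (hμ : SpectralBounds μ M α K) {x : ℝ → X} {u : ℝ → EuclideanSpace ℂ J}
    {y : ℝ → EuclideanSpace ℂ I} (hsol : (hBC.node hμ).IsClassicalSolution x u y)
    (k : ι) {t : ℝ} (ht : 0 ≤ t) :
    rieszCoord Q k (x t) = modeState (μ k)
      (fun j => extCoord T.generator β Q μ k (B (EuclideanSpace.single j 1)))
      (fun j r => u (max r 0) j) (rieszCoord Q k (x 0)) t := by
  have huc : Continuous fun r => u (max r 0) :=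
    hsol.input_continuous.comp_continuous (by fun_prop) fun r => le_max_right r 0
  have hdx : ∀ r, 0 ≤ r → HasDerivWithinAt x (derivWithin x (Ici 0) r) (Ici 0) r := fun r hr =>
    (hsol.state_C1.differentiableOn one_ne_zero r hr).hasDerivWithinAt
  refine eq_modeState (z := fun r => rieszCoord Q k (x r)) (f := fun j r => u (max r 0) j)
    (P := t) (fun j => (EuclideanSpace.proj (𝕜 := ℂ) j).continuous.comp huc) ?_ (fun r hr => ?_)
    ⟨ht, le_rfl⟩
  · exact (rieszCoord Q k).continuous.comp_continuousOn
      (hsol.state_C1.continuousOn.mono Icc_subset_Ici_self)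
  · have h1 := (((rieszCoord Q k).restrictScalars ℝ).hasFDerivAt (x := x r) |>.comp_hasDerivWithinAt r (hdx r hr.1)).mono
      (Ici_subset_Ici.2 hr.1)
    refine h1.congr_deriv ?_
    rw [ContinuousLinearMap.coe_restrictScalars', ← h.extCoord_incl β, hsol.state_eq r hr.1, map_add, h.extCoord_extA]
    simp only [max_eq_left hr.1]
    congr 1
    change extCoord T.generator β Q μ k (B (u r)) = _
    have h2 : u r = ∑ j, u r j • EuclideanSpace.single j (1 : ℂ) := by
      have := (EuclideanSpace.basisFun J ℂ).sum_repr (u r)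
      simp only [EuclideanSpace.basisFun_repr, EuclideanSpace.basisFun_apply] at this
      exact this.symm
    conv_lhs => rw [h2]
    simp only [map_sum, map_smul, smul_eq_mul]
    exact Finset.sum_congr rfl fun j _ => mul_comm _ _

/-- The state equation reads (β - A) x = (β x - x') + B u, the sum of an element of X and a term
with bounded coefficients. Hence the coordinates of x(t) are absolutely summable and C_Λ x(t) is
given by the series. -/
theorem CoeffBounds.hasSum_output (hBC : h.CoeffBounds B C Mb Mc)
    (hμ : SpectralBounds μ M α K) {x : ℝ → X} {u : ℝ → EuclideanSpace ℂ J}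
    {y : ℝ → EuclideanSpace ℂ I} (hsol : (hBC.node hμ).IsClassicalSolution x u y)
    {t : ℝ} (ht : 0 ≤ t) :
    HasSum (fun k => rieszCoord Q k (x t) • h.obsCoeff β C k) (y t) := by
  have h1 : Summable fun k => ‖rieszCoord Q k (x t)‖ := by
    refine h.summable_norm_rieszCoord hμ β
      (y := (β : ℂ) • x t - derivWithin x (Ici 0) t)
      (η := fun k => extCoord T.generator β Q μ k (B (u t))) (fun k => hBC.extCoord_le k _)
      fun k => ?_
    have h2 := congrArg (extCoord T.generator β Q μ k) (hsol.state_eq t ht)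
    rw [h.extCoord_incl, map_add, h.extCoord_extA] at h2
    change _ = _ + extCoord T.generator β Q μ k (B (u t)) at h2
    rw [map_sub, map_smul, smul_eq_mul, h2]
    ring
  have h3 := h.summable_smul_obsCoeff hBC.obsCoeff_le h1
  obtain ⟨hmem, hy⟩ := hsol.output_eq t ht
  have h4 : y t = lambdaExt T.generator β C ⟨x t, hmem⟩ := by
    rw [hy]
    change lambdaExt T.generator β C ⟨x t, hmem⟩ + 0 = _
    rw [add_zero]
  rw [h4, h.lambdaExt_eq_tsum hμ ⟨x t, hmem⟩ h3]
  exact h3.of_norm.hasSum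

theorem CoeffBounds.isWellPosed (hBC : h.CoeffBounds B C Mb Mc)
    (hμ : SpectralBounds μ M α K) : (hBC.node hμ).IsWellPosed := by
  intro τ hτ
  obtain ⟨L₁, hL₁, h₁⟩ := hμ.exists_sum_norm_sq_modeState_le (J := J) hτ Mb
  obtain ⟨L₂, hL₂, h₂⟩ := hμ.exists_integral_sum_modeState_le (J := J) hτ hBC.pos_left.le
    hBC.pos_right.le
  set q : ℝ := ‖(Q : lp (fun _ : ι => ℂ) 2 →L[ℂ] X)‖ ^ 2
  set q' : ℝ := ‖(Q.symm : X →L[ℂ] lp (fun _ : ι => ℂ) 2)‖ ^ 2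
  have hq : 0 ≤ q := by positivity
  have hq' : 0 ≤ q' := by positivity
  refine ⟨(q * L₁ + Fintype.card I * L₂) * (q' + 1) + 1, by positivity,
    fun x u y hsol => ?_⟩
  set b : ι → J → ℂ := fun k j => extCoord T.generator β Q μ k (B (EuclideanSpace.single j 1))
    with hb
  set f : J → ℝ → ℂ := fun j r => u (max r 0) j with hf
  set ξ : ι → ℂ := fun k => rieszCoord Q k (x 0) with hξ
  have huc : Continuous fun r => u (max r 0) :=
    hsol.input_continuous.comp_continuous (by fun_prop) fun r => le_max_right r 0
  have hfc : ∀ j, Continuous (f j) := fun j =>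
    (EuclideanSpace.proj (𝕜 := ℂ) j).continuous.comp huc
  have hbb : ∀ k j, ‖b k j‖ ≤ Mb := fun k j => by
    have := hBC.extCoord_le k (EuclideanSpace.single j (1 : ℂ))
    rwa [PiLp.norm_single, norm_one, mul_one] at this
  have hcc : ∀ k i, ‖h.obsCoeff β C k i‖ ≤ Mc := fun k i =>
    (PiLp.norm_apply_le _ i).trans (hBC.obsCoeff_le k)
  have hstate := fun k t (ht : 0 ≤ t) => hBC.coord_classicalSolution hμ hsol k ht
  set S : ℝ := ‖x 0‖ ^ 2 + ∫ t in (0 : ℝ)..τ, ‖u t‖ ^ 2 with hS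
  have hI : ∑ j, ∫ t in (0 : ℝ)..τ, ‖f j t‖ ^ 2 = ∫ t in (0 : ℝ)..τ, ‖u t‖ ^ 2 := by
    rw [integral_norm_sq_euclidean hτ.le (hsol.input_continuous.mono Icc_subset_Ici_self)]
    refine Finset.sum_congr rfl fun j _ => intervalIntegral.integral_congr fun t ht => ?_
    rw [uIcc_of_le hτ.le] at ht
    simp only [hf, max_eq_left ht.1]
  have hI0 : 0 ≤ ∫ t in (0 : ℝ)..τ, ‖u t‖ ^ 2 :=
    intervalIntegral.integral_nonneg hτ.le fun t _ => by positivity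
  have hS0 : 0 ≤ S := by positivity
  have hdata : ∀ F : Finset ι,
      ∑ k ∈ F, ‖ξ k‖ ^ 2 + ∑ j, ∫ t in (0 : ℝ)..τ, ‖f j t‖ ^ 2 ≤ (q' + 1) * S := by
    intro F
    have h3 := sum_norm_sq_rieszCoord_le Q (x 0) F
    rw [mul_pow] at h3
    rw [hI]
    nlinarith [mul_nonneg hq' hI0, sq_nonneg ‖x 0‖]
  have hx : ‖x τ‖ ^ 2 ≤ q * (L₁ * ((q' + 1) * S)) := by
    refine norm_sq_le_of_sum_rieszCoord_le Q fun F => ?_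
    simp only [hstate _ τ hτ.le]
    refine (h₁ F b f ξ hfc hbb).trans ?_
    gcongr
    exact hdata F
  have hy : ∫ t in (0 : ℝ)..τ, ‖y t‖ ^ 2 ≤ Fintype.card I * (L₂ * ((q' + 1) * S)) := by
    rw [integral_norm_sq_euclidean hτ.le (hsol.output_continuous.mono Icc_subset_Ici_self)]
    refine (Finset.sum_le_card_nsmul _ _ (L₂ * ((q' + 1) * S)) fun i _ => ?_).trans (by simp)
    have hyc : ContinuousOn (fun t => y t i) (Icc 0 τ) :=
      (EuclideanSpace.proj (𝕜 := ℂ) i).continuous.comp_continuousOn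
        (hsol.output_continuous.mono Icc_subset_Ici_self)
    -- Each scalar output component is a pointwise sum of modes, and its finite partial sums satisfy
    -- the energy estimate with a constant free of F.
    refine integral_norm_sq_le_of_hasSum hτ.le (g := fun k t =>
      modeState (μ k) (b k) f (ξ k) t * h.obsCoeff β C k i) (fun k => ?_) hyc (fun t ht => ?_)
      fun F => ?_
    · exact (continuous_iff_continuousAt.2 fun t =>
        (hasDerivAt_modeState (μ k) (b k) hfc (ξ k) t).continuousAt).mul continuous_const
    · have h3 := (hBC.hasSum_output hμ hsol ht.1).mapL (EuclideanSpace.proj (𝕜 := ℂ) i)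
      refine h3.congr_fun fun k => ?_
      rw [map_smul, hstate k t ht.1]
      rfl
    · refine (h₂ F b _ f ξ hfc hbb fun k => hcc k i).trans ?_
      gcongr
      exact hdata F
  calc _ ≤ q * (L₁ * ((q' + 1) * S)) + Fintype.card I * (L₂ * ((q' + 1) * S)) := add_le_add hx hy
    _ ≤ _ := by
      refine (le_add_of_nonneg_right hS0).trans (le_of_eq ?_)
      ring

end IsEigenbasis

end WellPosedness

theorem corollary2p8 {X : Type*} [NormedAddCommGroup X] [InnerProductSpace ℂ X] [CompleteSpace X]
    (T : C0Semigroup X) (β : resolvSet T.generator) (m p : ℕ)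
    (B : EuclideanSpace ℂ (Fin m) →L[ℂ] XNeg T.generator β)
    (hB : IsAdmissibleControl T β B)
    (C : XOne T.generator β →L[ℂ] EuclideanSpace ℂ (Fin p))
    (hC : IsAdmissibleObservation T β C)
    (φ : ℕ+ → X) (hφ : IsRieszBasis φ)
    (hdom : ∀ k, φ k ∈ T.generator.domain) (μ : ℕ+ → ℂ)
    (heig : ∀ k, T.generator ⟨φ k, hdom k⟩ = μ k • φ k)
    (a : ℝ) (ha : 0 < a)
    (hμ : ∃ M : ℝ, ∀ k : ℕ+, ‖μ k - Complex.I * (a : ℂ) * (k : ℂ) ^ 2‖ ≤ M) :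
    ∃ N : CompatibleSystemNode T β (EuclideanSpace ℂ (Fin m)) (EuclideanSpace ℂ (Fin p)),
      N.B = B ∧ N.C = lambdaExt T.generator β C ∧ N.D = 0 ∧
        N.IsWellPosed ∧ N.IsStrictlyProper := by
  obtain ⟨Q, hQ⟩ := hφ
  obtain rfl : φ = rieszVec Q := funext hQ
  have h : IsEigenbasis T.generator Q μ := ⟨hdom, heig⟩
  obtain ⟨M, α, K, hspec⟩ := exists_spectralBounds ha hμ
  obtain ⟨Mb, hMb, hb⟩ := h.exists_norm_extCoord_comp_le hspec hB
  obtain ⟨Mc, hc⟩ := h.exists_obsCoeff_le hspec hC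
  have hMc : 0 ≤ Mc := (norm_nonneg _).trans (hc 1)
  -- The bound obtained for the observation coefficients is only known to be nonnegative; adding 1
  -- makes it strictly positive.
  have hBC : h.CoeffBounds B C Mb (Mc + 1) :=
    ⟨hMb, by positivity, hb, fun k => (hc k).trans (le_add_of_nonneg_right zero_le_one)⟩
  exact ⟨hBC.node hspec, rfl, rfl, rfl, hBC.isWellPosed hspec, hBC.isStrictlyProper hspec⟩
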